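/- All graphs are finite. An \emph{ordered bigraph} $G$ is a bipartite graph with a given bipartition $(V_1(G),V_2(G))$ together with a linear order on $V_1(G)$ and a linear order on $V_2(G)$; it is an \emph{ordered tree bigraph} if its underlying graph is a tree. An ordered bigraph $G$ \emph{contains} an ordered bigraph $H$ if there is an isomorphism from $H$ to an induced subgraph of $G$ that maps $V_i(H)$ into $V_i(G)$ and preserves the linear order on $V_i(H)$, for $i=1,2$. Two disjoint sets of vertices are \emph{anticomplete} if there are no edges between them. \textbf{Theorem.} Let $T$ be an ordered tree bigraph. For all $c>0$ there exists $\varepsilon>0$ with the following property. Let $G$ be an ordered bigraph with at least one vertex, not containing $T$, such that every vertex in $V_1(G)$ has degree less than $\varepsilon|V_2(G)|$, and every vertex in $V_2(G)$ has degree less than $\varepsilon|V_1(G)|$. Then there are subsets $Z_i\subseteq V_i(G)$ for $i=1,2$, either with $|Z_1|\ge\varepsilon|V_1(G)|$ and $|Z_2|\ge\varepsilon|V_2(G)|^{1-c}$, or with $|Z_1|\ge\varepsilon|V_1(G)|^{1-c}$ and $|Z_2|\ge\varepsilon|V_2(G)|$, such that $Z_1,Z_2$ are anticomplete. -/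

import Mathlib

/-- A bigraph: a graph together with a bipartition of its vertex set into two sides, here the two
summands of `V₁ ⊕ V₂`. An ordered bigraph is a bigraph together with linear orders on `V₁` and
on `V₂` (given as `LinearOrder` instances); there is no order between the two sides. -/
structure Bigraph (V₁ : Type*) (V₂ : Type*) where
  /-- the underlying graph -/
  graph : SimpleGraph (V₁ ⊕ V₂)
  /-- every edge has one end in each side -/
  bipartite : graph.IsBipartiteWith (Set.range Sum.inl) (Set.range Sum.inr)

namespace Bigraph

/-- The degree of a vertex: its number of neighbours (all graphs are finite). -/
noncomputable def degree {V₁ V₂ : Type*} (G : Bigraph V₁ V₂) (v : V₁ ⊕ V₂) : ℕ :=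
  (G.graph.neighborSet v).ncard

/-- The ordered bigraph `G` contains the ordered bigraph `H`: there is an isomorphism from `H` to
an induced subgraph of `G` that maps each side of `H` into the same side of `G` and preserves the
linear order of each side. -/
def Contains {V₁ V₂ W₁ W₂ : Type*} [LinearOrder V₁] [LinearOrder V₂]
    [LinearOrder W₁] [LinearOrder W₂] (G : Bigraph V₁ V₂) (H : Bigraph W₁ W₂) : Prop :=
  ∃ (f₁ : W₁ ↪o V₁) (f₂ : W₂ ↪o V₂), ∀ u v : W₁ ⊕ W₂,
    G.graph.Adj (Sum.map f₁ f₂ u) (Sum.map f₁ f₂ v) ↔ H.graph.Adj u v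

/-- No edges between `Z₁ ⊆ V₁` and `Z₂ ⊆ V₂`. -/
def Anticomplete {V₁ V₂ : Type*} (G : Bigraph V₁ V₂) (Z₁ : Finset V₁) (Z₂ : Finset V₂) : Prop :=
  ∀ x ∈ Z₁, ∀ y ∈ Z₂, ¬ G.graph.Adj (Sum.inl x) (Sum.inr y)

end Bigraph

universe u₁ u₂ v₁ v₂

/-!
The theorem is proved by contradiction. A counterexample `G` is a sparse bipartite graph in which
every linear-sized subset of one side has edges to every polynomially small subset of the other
side, where a set is called polynomially small if its size is at least a constant times the power
`1 - c` (or `1 - c / 2`) of the size of its side. Such bigraphs are called coherent (`Coherent`,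
`coherent_of_forall`), and every coherent ordered bigraph contains every ordered tree
(`exists_contains_of_coherent`).

To respect the orders, each side is cut into a bounded number of consecutive blocks of linear size
(`exists_blocks`), and each vertex of the tree is to be placed in a block of its own, the index of
the block being its position. The tree is rooted and built from the deepest level up to the root.
After the level `k` has been treated (`HasLevel`), each position `i` of that side has polynomially
small sets `Z i a`, each vertex of which is the root of a copy of the subtree at any vertex of level
`k` that is placed at `i`. On both sides linear-sized parts of the blocks remain that see no vertex
of these copies other than the roots. Several indices `a` are needed, since the next step uses up
one set `Z i a` for each of the sets it produces. The number of positions is large for deep levels;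
each step passes to a few of the positions of one side.

The step (`Coherent.exists_next_level`, `HasLevel.step`) takes linear-sized sets `L y` on one side
and the polynomially small sets `Z` on the other side. It has to find vertices in `L y` with a
neighbour in each of the sets `Z` belonging to its children, such that these neighbours are seen by
none of the other sets under construction. This rests on the following facts.

* Up to constant factors, all degrees from the `L y` to the sets `Z` may be assumed to agree within
  a factor `Δ = n ^ δ`, robustly under deleting half of a set `Z` (`exists_regular`). Only boundedly
  many scales occur, because coherence excludes very small degrees (`Coherent.exists_high_degree`).
* By the pigeonhole principle over the many positions `y`, for a prescribed number of them the
  scales agree.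
* If a set `A` has degree at least `d` to `B`, and other sets `C i` have degree at most `d * Δ`
  to `B`, then some `X ⊆ B` covers a `Δ⁻¹` proportion of `A` and leaves half of each `C i` uncovered
  (`exists_cover`). Restricting `A` to its covered part and the `C i` to their uncovered parts gives
  the required neighbours and the required absence of edges (`exists_covers`,
  `exists_covered_targets`).

The losses by factors `Δ` accumulate to at most `n ^ (c / 2)`, as each target set is covered only
once from each position.
-/

namespace BigraphTree

open Finset

/-! ### Covering -/

open Classical in
/-- The neighbours of `a` in the set `B`. -/
noncomputable def nbr {V : Type*} (G : SimpleGraph V) (a : V) (B : Finset V) : Finset V :=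
  B.filter (G.Adj a)

open Classical in
/-- The vertices of `A` that have a neighbour in `X`. -/
noncomputable def covered {V : Type*} (G : SimpleGraph V) (X A : Finset V) : Finset V :=
  A.filter (fun a => ∃ b ∈ X, G.Adj a b)

open Classical in
/-- The vertices of `A` that have no neighbour in `X`. -/
noncomputable def uncovered {V : Type*} (G : SimpleGraph V) (X A : Finset V) : Finset V :=
  A.filter (fun a => ∀ b ∈ X, ¬ G.Adj a b)

/-- There are no edges between `A` and `B`. -/
def Anti {V : Type*} (G : SimpleGraph V) (A B : Finset V) : Prop :=
  ∀ a ∈ A, ∀ b ∈ B, ¬ G.Adj a b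

section Cover

variable {V : Type*} {G : SimpleGraph V}

theorem mem_nbr {a b : V} {B : Finset V} : b ∈ nbr G a B ↔ b ∈ B ∧ G.Adj a b := by
  simp [nbr]

theorem mem_covered {a : V} {X A : Finset V} :
    a ∈ covered G X A ↔ a ∈ A ∧ ∃ b ∈ X, G.Adj a b := by
  simp [covered]

theorem mem_uncovered {a : V} {X A : Finset V} :
    a ∈ uncovered G X A ↔ a ∈ A ∧ ∀ b ∈ X, ¬ G.Adj a b := by
  simp [uncovered]

theorem nbr_subset (a : V) (B : Finset V) : nbr G a B ⊆ B := fun _ h => (mem_nbr.1 h).1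

theorem covered_subset (X A : Finset V) : covered G X A ⊆ A := fun _ h => (mem_covered.1 h).1

theorem uncovered_subset (X A : Finset V) : uncovered G X A ⊆ A :=
  fun _ h => (mem_uncovered.1 h).1

theorem nbr_mono {a : V} {B C : Finset V} (h : B ⊆ C) : nbr G a B ⊆ nbr G a C :=
  fun _ hb => mem_nbr.2 ⟨h (mem_nbr.1 hb).1, (mem_nbr.1 hb).2⟩

theorem Anti.symm {A B : Finset V} (h : Anti G A B) : Anti G B A :=
  fun b hb a ha hab => h a ha b hb hab.symm

theorem Anti.mono {A B A' B' : Finset V} (h : Anti G A B) (hA : A' ⊆ A) (hB : B' ⊆ B) :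
    Anti G A' B' :=
  fun a ha b hb => h a (hA ha) b (hB hb)

theorem card_covered_add_card_uncovered (X A : Finset V) :
    #(covered G X A) + #(uncovered G X A) = #A := by
  classical
  have h := A.card_filter_add_card_filter_not (p := fun a => ∃ b ∈ X, G.Adj a b)
  rw [← h]
  congr 2
  ext a
  simp [mem_uncovered]

/-- Counting the edges between two sets from either end. -/
theorem sum_card_nbr_comm (A B : Finset V) :
    ∑ a ∈ A, (#(nbr G a B) : ℝ) = ∑ b ∈ B, (#(nbr G b A) : ℝ) := by
  classical
  have h := Finset.sum_card_bipartiteAbove_eq_sum_card_bipartiteBelow (s := A) (t := B) G.Adj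
  have h1 : ∀ a, A.bipartiteBelow G.Adj a = nbr G a A := fun a => by
    ext x; simp [mem_nbr, Finset.bipartiteBelow, G.adj_comm]
  have h2 : ∀ a, B.bipartiteAbove G.Adj a = nbr G a B := fun a => by
    ext x; simp [mem_nbr, Finset.bipartiteAbove]
  simp only [h1, h2] at h
  exact_mod_cast h

/-- The vertices of `B` seeing at least a proportion `τ` of `A` are few when each vertex of `A`
sees a small proportion of `B`. -/
theorem card_heavy_le {A B : Finset V} {d τ : ℝ} (hd : ∀ a ∈ A, (#(nbr G a B) : ℝ) ≤ d)
    {D : Finset V} (hD : D ⊆ B) (hτ : ∀ b ∈ D, τ * #A < (#(nbr G b A) : ℝ)) :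
    #D * (τ * #A) ≤ d * #A := by
  calc (#D : ℝ) * (τ * #A) = ∑ _b ∈ D, τ * (#A : ℝ) := by simp
    _ ≤ ∑ b ∈ D, (#(nbr G b A) : ℝ) := sum_le_sum fun b hb => (hτ b hb).le
    _ ≤ ∑ b ∈ B, (#(nbr G b A) : ℝ) :=
        sum_le_sum_of_subset_of_nonneg hD fun _ _ _ => by positivity
    _ = ∑ a ∈ A, (#(nbr G a B) : ℝ) := (sum_card_nbr_comm A B).symm
    _ ≤ ∑ _a ∈ A, d := sum_le_sum hd
    _ = d * #A := by simp [mul_comm]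

/-- If every vertex of `A` has at least `d` neighbours in `B`, while every vertex of the sets `C i`
has at most `d * Δ`, then some `X ⊆ B` covers a `Δ⁻¹` proportion of `A` up to a constant and leaves
half of each `C i` uncovered. A set `X` that is maximal among those covering the `C i` not much
better than `A` works, since averaging over `B` always provides a vertex to add to it. -/
theorem exists_cover {ι : Type*} (I : Finset ι) (C : ι → Finset V) (A B : Finset V)
    {d Δ m : ℝ} (hd : 0 < d) (hΔ : 1 ≤ Δ) (hm : 1 ≤ m) (hI : (#I : ℝ) ≤ m)
    (hA : ∀ a ∈ A, d ≤ #(nbr G a B))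
    (hC : ∀ i ∈ I, ∀ x ∈ C i, (#(nbr G x B) : ℝ) ≤ d * Δ)
    (hB : ∀ b ∈ B, ∀ i ∈ I, (#(nbr G b (C i)) : ℝ) ≤ #(C i) / 4) :
    ∃ X ⊆ B, (∀ i ∈ I, (#(C i) : ℝ) / 2 ≤ #(uncovered G X (C i))) ∧
      (#A : ℝ) / (16 * m * Δ) ≤ #(covered G X A) := by
  classical
  rcases A.eq_empty_or_nonempty with rfl | hAne
  · refine ⟨∅, by simp, fun i _ => ?_, by simp⟩
    have : uncovered G ∅ (C i) = C i := by ext; simp [mem_uncovered]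
    rw [this]
    have : (0 : ℝ) ≤ #(C i) := by positivity
    linarith
  have hA0 : (0 : ℝ) < #A := by exact_mod_cast hAne.card_pos
  have hmΔ : 1 ≤ m * Δ := one_le_mul_of_one_le_of_one_le hm hΔ
  let good : Finset V → Prop := fun X =>
    (∀ i ∈ I, (#(covered G X (C i)) : ℝ) ≤ #(C i) / 2) ∧
    ∑ i ∈ I, (#(covered G X (C i)) : ℝ) / #(C i) ≤ 4 * m * Δ * (#(covered G X A) / #A)
  have h0 : good ∅ := by
    have : ∀ A : Finset V, covered G ∅ A = ∅ := fun A => by ext; simp [mem_covered]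
    simp only [good, this]
    simp
    intros; positivity
  obtain ⟨X, hX, hmax⟩ := (B.powerset.filter good).exists_max_image card
    ⟨∅, by simp [h0]⟩
  simp only [mem_filter, mem_powerset, and_imp] at hX hmax
  obtain ⟨hXB, hX1, hX2⟩ := hX
  refine ⟨X, hXB, fun i hi => ?_, ?_⟩
  · have h1 := hX1 i hi
    have h2 := card_covered_add_card_uncovered (G := G) X (C i)
    have h3 : (#(covered G X (C i)) : ℝ) + #(uncovered G X (C i)) = #(C i) := by exact_mod_cast h2
    linarith
  by_contra! hlt
  have hcovA : (#(covered G X A) : ℝ) / #A < 1 / (16 * m * Δ) := by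
    rw [div_lt_div_iff₀ hA0 (by positivity)]
    rw [lt_div_iff₀ (by positivity)] at hlt
    linarith
  have hsum : ∑ i ∈ I, (#(covered G X (C i)) : ℝ) / #(C i) ≤ 1 / 4 := by
    refine hX2.trans ?_
    have : 4 * m * Δ * (1 / (16 * m * Δ)) = 1 / 4 := by field_simp; norm_num
    rw [← this]
    exact mul_le_mul_of_nonneg_left hcovA.le (by positivity)
  have hunc : (#A : ℝ) / 2 ≤ #(uncovered G X A) := by
    have h3 : (#(covered G X A) : ℝ) + #(uncovered G X A) = #A := by
      exact_mod_cast card_covered_add_card_uncovered (G := G) X A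
    have h4 : (#A : ℝ) / (16 * m * Δ) ≤ #A / 2 := by
      apply div_le_div_of_nonneg_left hA0.le (by norm_num)
      nlinarith
    linarith
  -- averaging over `B` finds a vertex whose gain on `A` outweighs its damage to the `C i`
  have havg : ∃ b ∈ B, ∑ i ∈ I, (#(nbr G b (C i)) : ℝ) / #(C i) <
      4 * m * Δ * (#(nbr G b (uncovered G X A)) / #A) := by
    by_contra! hcon
    have h1 := sum_le_sum hcon
    have h2 : 2 * m * Δ * d ≤
        ∑ b ∈ B, 4 * m * Δ * ((#(nbr G b (uncovered G X A)) : ℝ) / #A) := by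
      rw [← mul_sum, ← sum_div, ← sum_card_nbr_comm]
      have h3 : d * (#A / 2) ≤ ∑ a ∈ uncovered G X A, (#(nbr G a B) : ℝ) := by
        calc d * (#A / 2) ≤ d * #(uncovered G X A) := mul_le_mul_of_nonneg_left hunc hd.le
          _ = ∑ _a ∈ uncovered G X A, d := by simp [mul_comm]
          _ ≤ _ := sum_le_sum fun a ha => hA a (uncovered_subset _ _ ha)
      calc 2 * m * Δ * d = 4 * m * Δ * ((d * (#A / 2)) / #A) := by field_simp; ring
        _ ≤ _ := by gcongr
    have h4 : ∑ b ∈ B, ∑ i ∈ I, (#(nbr G b (C i)) : ℝ) / #(C i) ≤ m * (d * Δ) := by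
      rw [sum_comm]
      calc ∑ i ∈ I, ∑ b ∈ B, (#(nbr G b (C i)) : ℝ) / #(C i) ≤ ∑ _i ∈ I, d * Δ := by
            refine sum_le_sum fun i hi => ?_
            rw [← sum_div, ← sum_card_nbr_comm]
            rcases (C i).eq_empty_or_nonempty with he | hne
            · simp [he]; positivity
            rw [div_le_iff₀ (by exact_mod_cast hne.card_pos)]
            calc _ ≤ ∑ _x ∈ C i, d * Δ := sum_le_sum (hC i hi)
              _ = _ := by simp [mul_comm]
        _ = #I * (d * Δ) := by simp
        _ ≤ _ := by gcongr
    have h5 : 0 < m * Δ * d := by positivity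
    nlinarith
  obtain ⟨b, hbB, hb⟩ := havg
  have hbX : b ∉ X := by
    intro hbX
    have : nbr G b (uncovered G X A) = ∅ := by
      ext a
      simp only [mem_nbr, mem_uncovered, notMem_empty, iff_false]
      rintro ⟨⟨_, h⟩, hab⟩
      exact h b hbX hab.symm
    rw [this] at hb
    simp only [card_empty, Nat.cast_zero, zero_div, mul_zero] at hb
    exact absurd hb (not_lt.2 (sum_nonneg fun _ _ => by positivity))
  have hins : ∀ D : Finset V, (#(covered G (insert b X) D) : ℝ) ≤
      #(covered G X D) + #(nbr G b D) := by
    intro D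
    have : covered G (insert b X) D ⊆ covered G X D ∪ nbr G b D := by
      intro a ha
      simp only [mem_covered, mem_union, mem_nbr, mem_insert] at ha ⊢
      obtain ⟨haD, x, rfl | hx, hax⟩ := ha
      · exact Or.inr ⟨haD, hax.symm⟩
      · exact Or.inl ⟨haD, x, hx, hax⟩
    exact_mod_cast (card_le_card this).trans (card_union_le _ _)
  have hinsA : (#(covered G X A) : ℝ) + #(nbr G b (uncovered G X A)) ≤
      #(covered G (insert b X) A) := by
    have hdis : Disjoint (covered G X A) (nbr G b (uncovered G X A)) := by
      rw [disjoint_left]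
      intro a ha ha'
      obtain ⟨_, x, hx, hax⟩ := mem_covered.1 ha
      exact (mem_uncovered.1 (mem_nbr.1 ha').1).2 x hx hax
    have hsub : covered G X A ∪ nbr G b (uncovered G X A) ⊆ covered G (insert b X) A := by
      intro a ha
      simp only [mem_covered, mem_union, mem_nbr, mem_uncovered, mem_insert] at ha ⊢
      rcases ha with ⟨haA, x, hx, hax⟩ | ⟨⟨haA, _⟩, hab⟩
      · exact ⟨haA, x, Or.inr hx, hax⟩
      · exact ⟨haA, b, Or.inl rfl, hab.symm⟩
    have := card_le_card hsub
    rw [card_union_of_disjoint hdis] at this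
    exact_mod_cast this
  have hgood : good (insert b X) := by
    refine ⟨fun i hi => ?_, ?_⟩
    · have h1 : (#(covered G X (C i)) : ℝ) / #(C i) ≤ 1 / 4 :=
        (single_le_sum (f := fun i => (#(covered G X (C i)) : ℝ) / #(C i))
          (fun _ _ => by positivity) hi).trans hsum
      have h2 : (#(covered G X (C i)) : ℝ) ≤ #(C i) / 4 := by
        rcases (C i).eq_empty_or_nonempty with he | hne
        · have : covered G X (C i) = ∅ := subset_empty.1 (he ▸ covered_subset X (C i))
          rw [this]; simp; positivity
        rw [div_le_iff₀ (by exact_mod_cast hne.card_pos)] at h1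
        linarith
      have h3 := hB b hbB i hi
      have h4 := hins (C i)
      linarith
    · calc ∑ i ∈ I, (#(covered G (insert b X) (C i)) : ℝ) / #(C i)
          ≤ ∑ i ∈ I, ((#(covered G X (C i)) : ℝ) / #(C i) + #(nbr G b (C i)) / #(C i)) := by
            refine sum_le_sum fun i _ => ?_
            rw [← add_div]
            exact div_le_div_of_nonneg_right (hins (C i)) (by positivity)
        _ ≤ 4 * m * Δ * (#(covered G X A) / #A) +
              4 * m * Δ * (#(nbr G b (uncovered G X A)) / #A) := by
            rw [sum_add_distrib]; exact add_le_add hX2 hb.le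
        _ = 4 * m * Δ * ((#(covered G X A) + #(nbr G b (uncovered G X A))) / #A) := by ring
        _ ≤ _ := by gcongr
  have := hmax (insert b X) (insert_subset hbB hXB) hgood
  rw [card_insert_of_notMem hbX] at this
  omega

/-- Iterated form of `exists_cover`: a constant proportion of each `C i` survives, and the part of
`A` that survives is covered by every one of the sets `X x ⊆ B x`. -/
theorem exists_covers {ι ξ : Type*} (I : Finset ι) (Q : Finset ξ) (B : ξ → Finset V) (d : ξ → ℝ)
    {Δ m : ℝ} (hd : ∀ x, 0 < d x) (hΔ : 1 ≤ Δ) (hm : 1 ≤ m) (hI : (#I : ℝ) ≤ m)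
    (C : ι → Finset V) (A : Finset V)
    (hA : ∀ x ∈ Q, ∀ a ∈ A, d x ≤ #(nbr G a (B x)))
    (hC : ∀ x ∈ Q, ∀ i ∈ I, ∀ y ∈ C i, (#(nbr G y (B x)) : ℝ) ≤ d x * Δ)
    (hB : ∀ x ∈ Q, ∀ b ∈ B x, ∀ i ∈ I, (#(nbr G b (C i)) : ℝ) ≤ (1 / 2) ^ (#Q + 2) * #(C i)) :
    ∃ (X : ξ → Finset V) (C' : ι → Finset V) (A' : Finset V), (∀ x, X x ⊆ B x) ∧ A' ⊆ A ∧
      (∀ i, C' i ⊆ C i) ∧ (∀ i ∈ I, ∀ x ∈ Q, Anti G (C' i) (X x)) ∧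
      (∀ i ∈ I, (1 / 2) ^ #Q * (#(C i) : ℝ) ≤ #(C' i)) ∧
      (∀ a ∈ A', ∀ x ∈ Q, ∃ b ∈ X x, G.Adj a b) ∧
      (1 / (16 * m * Δ)) ^ #Q * (#A : ℝ) ≤ #A' := by
  classical
  induction Q using Finset.induction_on with
  | empty => exact ⟨fun _ => ∅, C, A, by simp, by simp, by simp, by simp, by simp, by simp, by simp⟩
  | insert x Q hx ih =>
    rw [card_insert_of_notMem hx] at hB ⊢
    obtain ⟨X, C', A', hXB, hA', hC', hanti, hCc, hcov, hAc⟩ := ih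
      (fun z hz => hA z (mem_insert_of_mem hz)) (fun z hz => hC z (mem_insert_of_mem hz))
      (fun z hz b hb i hi => (hB z (mem_insert_of_mem hz) b hb i hi).trans (by
        apply mul_le_mul_of_nonneg_right _ (by positivity)
        exact pow_le_pow_of_le_one (by norm_num) (by norm_num) (by omega)))
    obtain ⟨Y, hYB, hYC, hYA⟩ := exists_cover (G := G) I C' A' (B x) (hd x) hΔ hm hI
      (fun a ha => hA x (mem_insert_self _ _) a (hA' ha))
      (fun i hi y hy => hC x (mem_insert_self _ _) i hi y (hC' i hy))
      (fun b hb i hi => by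
        have h1 := hB x (mem_insert_self _ _) b hb i hi
        have h2 : (#(nbr G b (C' i)) : ℝ) ≤ #(nbr G b (C i)) := by
          exact_mod_cast card_le_card (nbr_mono (hC' i))
        have h3 := hCc i hi
        have h4 : (1 / 2 : ℝ) ^ (#Q + 1 + 2) * #(C i) = (1 / 2) ^ #Q * #(C i) / 8 := by ring
        have h5 : (0 : ℝ) ≤ #(C' i) := by positivity
        rw [h4] at h1
        linarith)
    refine ⟨Function.update X x Y, fun i => uncovered G Y (C' i), covered G Y A', ?_,
      (covered_subset _ _).trans hA', fun i => (uncovered_subset _ _).trans (hC' i), ?_, ?_, ?_, ?_⟩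
    · intro z
      by_cases hz : z = x
      · subst hz; simpa using hYB
      · simpa [hz] using hXB z
    · intro i hi z hz
      rcases mem_insert.1 hz with rfl | hzQ
      · simp only [Function.update_self]
        exact fun a ha b hb => (mem_uncovered.1 ha).2 b hb
      · rw [Function.update_of_ne (by rintro rfl; exact hx hzQ)]
        exact (hanti i hi z hzQ).mono (uncovered_subset _ _) (Subset.refl _)
    · intro i hi
      have h1 := hCc i hi
      have h2 := hYC i hi
      calc (1 / 2 : ℝ) ^ (#Q + 1) * #(C i) = (1 / 2) ^ #Q * #(C i) / 2 := by ring
        _ ≤ #(C' i) / 2 := by linarith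
        _ ≤ _ := h2
    · intro a ha z hz
      obtain ⟨haA, b, hb, hab⟩ := mem_covered.1 ha
      rcases mem_insert.1 hz with rfl | hzQ
      · simpa using ⟨b, hb, hab⟩
      · rw [Function.update_of_ne (by rintro rfl; exact hx hzQ)]
        exact hcov a haA z hzQ
    · have h0 : (0 : ℝ) < 16 * m * Δ := by positivity
      calc (1 / (16 * m * Δ)) ^ (#Q + 1) * (#A : ℝ)
          = (1 / (16 * m * Δ)) ^ #Q * #A / (16 * m * Δ) := by rw [pow_succ]; ring
        _ ≤ #A' / (16 * m * Δ) := by gcongr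
        _ ≤ _ := hYA

end Cover

/-! ### Regularising degrees -/

section Regular

variable {V : Type*} {G : SimpleGraph V}

open Classical in
/-- The vertices of `A` with fewer than `d` neighbours in `B`. -/
noncomputable def lowDegree (G : SimpleGraph V) (d : ℝ) (B A : Finset V) : Finset V :=
  A.filter (fun a => (#(nbr G a B) : ℝ) < d)

theorem mem_lowDegree {d : ℝ} {B A : Finset V} {a : V} :
    a ∈ lowDegree G d B A ↔ a ∈ A ∧ (#(nbr G a B) : ℝ) < d := by
  simp [lowDegree]

theorem lowDegree_subset (d : ℝ) (B A : Finset V) : lowDegree G d B A ⊆ A :=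
  fun _ ha => (mem_lowDegree.1 ha).1

/-- After shrinking all the sets `L y` and `Z j` by a constant factor, the degrees from each `A y`
into each `B j` are, on the logarithmic scale given by `Δ`, as large as their upper bound, and stay
so for all but few vertices of `A y` when `B j` loses half of its vertices. Wherever this fails, the
failure gives smaller sets with an upper bound that is better by a factor `Δ`; by `hlow` this
happens at most `q` times for each pair. -/
theorem exists_regular {υ J : Type*} [Fintype υ] [Fintype J] (L : υ → Finset V) (Z : J → Finset V)
    {Δ η : ℝ} {q : ℕ} (hη : 0 < η) (hη2 : η ≤ 1 / 2) (hΔ : 1 ≤ Δ)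
    (hlow : ∀ y j, ∀ A ⊆ L y, ∀ B ⊆ Z j,
      η ^ (Fintype.card (υ × J) * q) * #(L y) ≤ #A → η ^ (Fintype.card (υ × J) * q) * #(Z j) ≤ #B →
        ∃ a ∈ A, (#(Z j) : ℝ) / Δ ^ q < #(nbr G a B)) :
    ∃ (A : υ → Finset V) (B : J → Finset V) (s : υ → J → ℕ),
      (∀ y, A y ⊆ L y) ∧ (∀ j, B j ⊆ Z j) ∧ (∀ y j, s y j < q) ∧
      (∀ y, η ^ (Fintype.card (υ × J) * q) * #(L y) ≤ #(A y)) ∧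
      (∀ j, η ^ (Fintype.card (υ × J) * q) * #(Z j) ≤ #(B j)) ∧
      (∀ y j, ∀ a ∈ A y, (#(nbr G a (B j)) : ℝ) ≤ #(Z j) / Δ ^ s y j) ∧
      ∀ y j, ∀ B' ⊆ B j, (#(B j) : ℝ) / 2 ≤ #B' →
        (#(lowDegree G (#(Z j) / Δ ^ (s y j + 1)) B' (A y)) : ℝ) ≤ η * #(A y) := by
  classical
  set S := Fintype.card (υ × J) * q with hS
  let valid : ℕ → Prop := fun N => ∃ (A : υ → Finset V) (B : J → Finset V) (s : υ × J → ℕ),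
      ∑ p, s p = N ∧ (∀ y, A y ⊆ L y) ∧ (∀ j, B j ⊆ Z j) ∧
      (∀ y, η ^ N * #(L y) ≤ #(A y)) ∧ (∀ j, η ^ N * #(Z j) ≤ #(B j)) ∧
      (∀ y j, ∀ a ∈ A y, (#(nbr G a (B j)) : ℝ) ≤ #(Z j) / Δ ^ s (y, j))
  have h0 : valid 0 := by
    refine ⟨L, Z, fun _ => 0, by simp, fun _ => Subset.refl _, fun _ => Subset.refl _, by simp,
      by simp, fun y j a _ => ?_⟩
    simpa using card_le_card (nbr_subset (G := G) a (Z j))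
  obtain ⟨A, B, s, hN, hA, hB, hAc, hBc, hup⟩ := Nat.findGreatest_spec (Nat.zero_le S) h0
  set N := Nat.findGreatest valid S with hNdef
  have hNS : N ≤ S := Nat.findGreatest_le S
  have hη1 : η ≤ 1 := by linarith
  have hpow : η ^ S ≤ η ^ N := pow_le_pow_of_le_one hη.le hη1 hNS
  have hAS : ∀ y, η ^ S * #(L y) ≤ #(A y) := fun y => le_trans (by gcongr) (hAc y)
  have hBS : ∀ j, η ^ S * #(Z j) ≤ #(B j) := fun j => le_trans (by gcongr) (hBc j)
  have hsq : ∀ y j, s (y, j) < q := by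
    intro y j
    by_contra! hq
    obtain ⟨a, ha, hlt⟩ := hlow y j (A y) (hA y) (B j) (hB j) (hAS y) (hBS j)
    have h1 := hup y j a ha
    have h2 : (#(Z j) : ℝ) / Δ ^ s (y, j) ≤ #(Z j) / Δ ^ q := by gcongr
    linarith
  refine ⟨A, B, fun y j => s (y, j), hA, hB, hsq, hAS, hBS, hup, fun y j B' hB' hB'c => ?_⟩
  by_contra! hirr
  have hlt : N < S := by
    rw [← hN, hS, ← Finset.card_univ, ← smul_eq_mul, ← Finset.sum_const]
    exact Finset.sum_lt_sum_of_nonempty ⟨(y, j), mem_univ _⟩ fun p _ => hsq p.1 p.2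
  have hvalid : valid (N + 1) := by
    refine ⟨Function.update A y (lowDegree G (#(Z j) / Δ ^ (s (y, j) + 1)) B' (A y)),
      Function.update B j B', s + Pi.single (y, j) 1, ?_, fun z => ?_, fun k => ?_, fun z => ?_,
      fun k => ?_, fun z k a ha => ?_⟩
    · simp [Finset.sum_add_distrib, hN]
    · by_cases hz : z = y
      · subst hz; simpa using (lowDegree_subset _ _ _).trans (hA z)
      · simpa [hz] using hA z
    · by_cases hk : k = j
      · subst hk; simpa using hB'.trans (hB k)
      · simpa [hk] using hB k
    · by_cases hz : z = y
      · subst hz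
        rw [Function.update_self, pow_succ]
        have := hAc z
        nlinarith
      · rw [Function.update_of_ne hz]
        exact le_trans (by gcongr ?_ * _; exact pow_le_pow_of_le_one hη.le hη1 (by omega)) (hAc z)
    · by_cases hk : k = j
      · subst hk
        rw [Function.update_self, pow_succ]
        have h1 := hBc k
        have h2 : (0 : ℝ) ≤ η ^ N * #(Z k) := by positivity
        nlinarith
      · rw [Function.update_of_ne hk]
        exact le_trans (by gcongr ?_ * _; exact pow_le_pow_of_le_one hη.le hη1 (by omega)) (hBc k)
    · have haz : a ∈ A z := by
        by_cases hz : z = y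
        · subst hz
          rw [Function.update_self] at ha
          exact (mem_lowDegree.1 ha).1
        · rwa [Function.update_of_ne hz] at ha
      have hBk : Function.update B j B' k ⊆ B k := by
        by_cases hk : k = j
        · subst hk; simpa using hB'
        · simp [hk]
      by_cases hp : z = y ∧ k = j
      · obtain ⟨rfl, rfl⟩ := hp
        rw [Function.update_self] at ha ⊢
        simpa using (mem_lowDegree.1 ha).2.le
      · have : (s + Pi.single (y, j) 1 : υ × J → ℕ) (z, k) = s (z, k) := by
          have hne : (z, k) ≠ (y, j) := fun h => hp (by simpa using h)
          simp [hne]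
        rw [this]
        refine le_trans ?_ (hup z k a haz)
        exact_mod_cast card_le_card (nbr_mono hBk)
  have := Nat.le_findGreatest hlt hvalid
  omega

end Regular

/-! ### Covering many targets -/

section Targets

variable {V : Type*} {G : SimpleGraph V}

/-- Each target `e t` is shrunk so that it is covered by sets `X t x ⊆ B t x` that avoid all the
other sets of the family. The targets are treated one after the other. When `t` is treated, the sets
of the family may already be very small, so a single vertex of `B t x` could cover most of some set;
such vertices are few and are discarded first, and `hreg` says that most vertices of `e t` keep their
degrees into `B t x` when this is done. -/
theorem exists_covered_targets {I τ ξ : Type*} [Fintype I] [Fintype τ] [Fintype ξ] [Nonempty I]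
    (e : τ → I) (he : Function.Injective e) (A : I → Finset V) (B : τ → ξ → Finset V)
    (D : τ → ξ → ℝ) {Δ η σ : ℝ} (hΔ : 1 ≤ Δ) (hσ : 0 ≤ σ)
    (hD : ∀ t x, 0 < D t x)
    (hup : ∀ t x i, ∀ a ∈ A i, (#(nbr G a (B t x)) : ℝ) ≤ D t x)
    (hup' : ∀ t x i, ∀ a ∈ A i, (#(nbr G a (B t x)) : ℝ) ≤ σ * #(B t x))
    (hσ' : Fintype.card I * σ ≤ (1 / 2) ^ (Fintype.card ξ + 3))
    (hreg : ∀ t x, ∀ B' ⊆ B t x, (#(B t x) : ℝ) / 2 ≤ #B' →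
      (#(lowDegree G (D t x / Δ) B' (A (e t))) : ℝ) ≤ η * #(A (e t)))
    (hη : Fintype.card ξ * η ≤ (1 / 2) ^ (Fintype.card ξ * Fintype.card τ + 1)) :
    ∃ (X : τ → ξ → Finset V) (C : I → Finset V), (∀ t x, X t x ⊆ B t x) ∧ (∀ i, C i ⊆ A i) ∧
      (∀ t x i, i ≠ e t → Anti G (C i) (X t x)) ∧
      (∀ t, ∀ a ∈ C (e t), ∀ x, ∃ b ∈ X t x, G.Adj a b) ∧
      (∀ i, (∀ t, e t ≠ i) → (1 / 2) ^ (Fintype.card ξ * Fintype.card τ) * (#(A i) : ℝ) ≤ #(C i)) ∧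
      (∀ t, (1 / 2) ^ (Fintype.card ξ * Fintype.card τ) *
        (1 / 2 * (1 / (16 * Fintype.card I * Δ)) ^ Fintype.card ξ * (#(A (e t)) : ℝ)) ≤
          #(C (e t))) := by
  classical
  set n := Fintype.card ξ with hn
  set m : ℝ := (Fintype.card I : ℝ) with hm
  have hm1 : 1 ≤ m := by
    rw [hm]
    exact_mod_cast Nat.succ_le_of_lt (Fintype.card_pos (α := I))
  set β : ℝ := 1 / 2 * (1 / (16 * m * Δ)) ^ n with hβ
  have hβ0 : 0 ≤ β := by positivity
  suffices H : ∀ Q : Finset τ, ∃ (X : τ → ξ → Finset V) (C : I → Finset V),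
      (∀ t x, X t x ⊆ B t x) ∧ (∀ i, C i ⊆ A i) ∧
      (∀ t ∈ Q, ∀ x i, i ≠ e t → Anti G (C i) (X t x)) ∧
      (∀ t ∈ Q, ∀ a ∈ C (e t), ∀ x, ∃ b ∈ X t x, G.Adj a b) ∧
      (∀ i, (∀ t ∈ Q, e t ≠ i) → (1 / 2) ^ (n * #Q) * (#(A i) : ℝ) ≤ #(C i)) ∧
      (∀ t ∈ Q, (1 / 2) ^ (n * #Q) * (β * (#(A (e t)) : ℝ)) ≤ #(C (e t))) by
    obtain ⟨X, C, h1, h2, h3, h4, h5, h6⟩ := H univ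
    rw [card_univ] at h5 h6
    exact ⟨X, C, h1, h2, fun t => h3 t (mem_univ t), fun t => h4 t (mem_univ t),
      fun i hi => h5 i fun t _ => hi t, fun t => h6 t (mem_univ t)⟩
  intro Q
  induction Q using Finset.induction_on with
  | empty => exact ⟨fun _ _ => ∅, A, by simp, by simp, by simp, by simp, by simp, by simp⟩
  | insert t Q ht ih =>
    obtain ⟨X, C, hXB, hCA, hanti, hcov, hsize, hsize'⟩ := ih
    set T : ℝ := (1 / 2) ^ (n + 2) with hT
    have hT0 : 0 < T := by positivity
    -- the vertices of `B t x` that do not cover much of any set of the family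
    let B' : ξ → Finset V := fun x =>
      (B t x).filter fun b => ∀ i, (#(nbr G b (C i)) : ℝ) ≤ T * #(C i)
    have hB'B : ∀ x, B' x ⊆ B t x := fun x => filter_subset _ _
    have hB'c : ∀ x, (#(B t x) : ℝ) / 2 ≤ #(B' x) := by
      intro x
      let bad : I → Finset V := fun i => (B t x).filter fun b => T * #(C i) < (#(nbr G b (C i)) : ℝ)
      have hbad : ∀ i, (#(bad i) : ℝ) ≤ σ / T * #(B t x) := by
        intro i
        rcases (C i).eq_empty_or_nonempty with hemp | hne
        · have : bad i = ∅ := by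
            simp [bad, hemp, nbr]
          rw [this]; simp; positivity
        have hpos : (0 : ℝ) < #(C i) := by exact_mod_cast hne.card_pos
        have := card_heavy_le (G := G) (A := C i) (B := B t x) (D := bad i)
          (fun a ha => hup' t x i a (hCA i ha)) (filter_subset _ _)
          (fun b hb => (mem_filter.1 hb).2)
        rw [div_mul_eq_mul_div, le_div_iff₀ hT0]
        rw [← mul_assoc] at this
        exact le_of_mul_le_mul_right this hpos
      have hsub : B t x ⊆ B' x ∪ univ.biUnion bad := by
        intro b hb
        by_cases h : ∀ i, (#(nbr G b (C i)) : ℝ) ≤ T * #(C i)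
        · exact mem_union_left _ (mem_filter.2 ⟨hb, h⟩)
        · push Not at h
          obtain ⟨i, hi⟩ := h
          exact mem_union_right _ (mem_biUnion.2 ⟨i, mem_univ i, mem_filter.2 ⟨hb, hi⟩⟩)
      have h1 : (#(B t x) : ℝ) ≤ #(B' x) + ∑ i, (#(bad i) : ℝ) := by
        exact_mod_cast (card_le_card hsub).trans
          ((card_union_le _ _).trans (Nat.add_le_add_left card_biUnion_le _))
      have h2 : ∑ i, (#(bad i) : ℝ) ≤ m * (σ / T * #(B t x)) := by
        refine (sum_le_sum fun i _ => hbad i).trans ?_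
        simp [hm]
      have h3 : m * (σ / T * #(B t x)) ≤ #(B t x) / 2 := by
        have : m * σ / T ≤ 1 / 2 := by
          rw [div_le_iff₀ hT0]
          refine hσ'.trans (le_of_eq ?_)
          rw [hT]; ring
        calc m * (σ / T * #(B t x)) = (m * σ / T) * #(B t x) := by ring
          _ ≤ 1 / 2 * #(B t x) := by gcongr
          _ = _ := by ring
      linarith
    -- the vertices of the target that keep their degrees into all the sets `B' x`
    let A₀ : Finset V := (C (e t)).filter fun a => ∀ x, D t x / Δ ≤ #(nbr G a (B' x))
    have hA₀ : (#(C (e t)) : ℝ) / 2 ≤ #A₀ ∧ (1 / 2) ^ (n * #Q) * (#(A (e t)) : ℝ) ≤ #(C (e t)) := by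
      have hsz := hsize (e t) (fun t' ht' h => ht (he h ▸ ht'))
      refine ⟨?_, hsz⟩
      have hsub : C (e t) ⊆
          A₀ ∪ univ.biUnion fun x => lowDegree G (D t x / Δ) (B' x) (A (e t)) := by
        intro a ha
        by_cases h : ∀ x, D t x / Δ ≤ #(nbr G a (B' x))
        · exact mem_union_left _ (mem_filter.2 ⟨ha, h⟩)
        · push Not at h
          obtain ⟨x, hx⟩ := h
          exact mem_union_right _ (mem_biUnion.2 ⟨x, mem_univ x, mem_lowDegree.2 ⟨hCA _ ha, hx⟩⟩)
      have h1 : (#(C (e t)) : ℝ) ≤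
          #A₀ + ∑ x, (#(lowDegree G (D t x / Δ) (B' x) (A (e t))) : ℝ) := by
        exact_mod_cast (card_le_card hsub).trans
          ((card_union_le _ _).trans (Nat.add_le_add_left card_biUnion_le _))
      have h2 : ∑ x, (#(lowDegree G (D t x / Δ) (B' x) (A (e t))) : ℝ) ≤ n * (η * #(A (e t))) := by
        refine (sum_le_sum fun x _ => hreg t x (B' x) (hB'B x) (hB'c x)).trans ?_
        simp [hn]
      have h3 : n * (η * #(A (e t))) ≤ (1 / 2) ^ (n * #Q) * #(A (e t)) / 2 := by
        calc n * (η * (#(A (e t)) : ℝ)) = (n * η) * #(A (e t)) := by ring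
          _ ≤ (1 / 2) ^ (n * Fintype.card τ + 1) * #(A (e t)) := by gcongr
          _ ≤ (1 / 2) ^ (n * #Q + 1) * #(A (e t)) := by
              gcongr ?_ * _
              exact pow_le_pow_of_le_one (by norm_num) (by norm_num)
                (Nat.succ_le_succ (Nat.mul_le_mul_left _ (card_le_univ _)))
          _ = _ := by ring
      linarith
    obtain ⟨hA₀c, hsz⟩ := hA₀
    obtain ⟨Y, C', A', hYB, hA'A, hC'C, hanti', hC'c, hcov', hA'c⟩ :=
      exists_covers (G := G) (univ.erase (e t)) (univ : Finset ξ) B' (fun x => D t x / Δ)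
        (Δ := Δ) (m := m) (fun x => div_pos (hD t x) (by linarith)) hΔ hm1
        (by rw [hm]; exact_mod_cast card_le_univ _) C A₀
        (fun x _ a ha => (mem_filter.1 ha).2 x)
        (fun x _ i _ y hy => by
          rw [div_mul_cancel₀ _ (by linarith)]
          refine le_trans ?_ (hup t x i y (hCA i hy))
          exact_mod_cast card_le_card (nbr_mono (hB'B x)))
        (fun x _ b hb i _ => by
          rw [card_univ]
          exact (mem_filter.1 hb).2 i)
    rw [card_univ, ← hn] at hC'c hA'c
    have hA'C : A' ⊆ C (e t) := hA'A.trans (filter_subset _ _)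
    refine ⟨Function.update X t Y, Function.update C' (e t) A', ?_, ?_, ?_, ?_, ?_, ?_⟩
    · intro t' x
      by_cases h : t' = t
      · subst h; simpa using (hYB x).trans (hB'B x)
      · simpa [h] using hXB t' x
    · intro i
      by_cases h : i = e t
      · subst h; simpa using hA'C.trans (hCA _)
      · simpa [h] using (hC'C i).trans (hCA i)
    · intro t' ht' x i hi
      have hsub : Function.update C' (e t) A' i ⊆ C i := by
        by_cases h : i = e t
        · subst h; simpa using hA'C
        · simpa [h] using hC'C i
      rcases mem_insert.1 ht' with rfl | htQ
      · simp only [Function.update_self, Function.update_of_ne hi]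
        exact hanti' i (mem_erase.2 ⟨hi, mem_univ i⟩) x (mem_univ x)
      · rw [Function.update_of_ne (show t' ≠ t by rintro rfl; exact ht htQ)]
        exact (hanti t' htQ x i hi).mono hsub (Subset.refl _)
    · intro t' ht' a ha x
      rcases mem_insert.1 ht' with rfl | htQ
      · simp only [Function.update_self] at ha ⊢
        exact hcov' a ha x (mem_univ x)
      · have hne : t' ≠ t := by rintro rfl; exact ht htQ
        rw [Function.update_of_ne hne]
        rw [Function.update_of_ne (fun h => hne (he h))] at ha
        exact hcov t' htQ a (hC'C _ ha) x
    · intro i hi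
      have hne : i ≠ e t := fun h => hi t (mem_insert_self _ _) h.symm
      rw [Function.update_of_ne hne, card_insert_of_notMem ht]
      have h1 := hsize i fun t' ht' => hi t' (mem_insert_of_mem ht')
      have h2 := hC'c i (mem_erase.2 ⟨hne, mem_univ i⟩)
      calc (1 / 2 : ℝ) ^ (n * (#Q + 1)) * #(A i)
          = (1 / 2) ^ n * ((1 / 2) ^ (n * #Q) * #(A i)) := by rw [Nat.mul_succ, pow_add]; ring
        _ ≤ (1 / 2) ^ n * #(C i) := by gcongr
        _ ≤ _ := h2
    · intro t' ht'
      rw [card_insert_of_notMem ht]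
      rcases mem_insert.1 ht' with rfl | htQ
      · rw [Function.update_self]
        calc (1 / 2 : ℝ) ^ (n * (#Q + 1)) * (β * #(A (e t')))
            = (1 / 2) ^ n * (β * ((1 / 2) ^ (n * #Q) * #(A (e t')))) := by
              rw [Nat.mul_succ, pow_add]; ring
          _ ≤ 1 * (β * ((1 / 2) ^ (n * #Q) * #(A (e t')))) := by
              gcongr
              exact pow_le_one₀ (by norm_num) (by norm_num)
          _ ≤ β * #(C (e t')) := by rw [one_mul]; gcongr
          _ = (1 / (16 * m * Δ)) ^ n * (#(C (e t')) / 2) := by rw [hβ]; ring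
          _ ≤ (1 / (16 * m * Δ)) ^ n * #A₀ := by gcongr
          _ ≤ _ := hA'c
      · have hne : t' ≠ t := by rintro rfl; exact ht htQ
        have hne' : e t' ≠ e t := fun h => hne (he h)
        rw [Function.update_of_ne hne']
        have h1 := hsize' t' htQ
        have h2 := hC'c (e t') (mem_erase.2 ⟨hne', mem_univ _⟩)
        calc (1 / 2 : ℝ) ^ (n * (#Q + 1)) * (β * #(A (e t')))
            = (1 / 2) ^ n * ((1 / 2) ^ (n * #Q) * (β * #(A (e t')))) := by
              rw [Nat.mul_succ, pow_add]; ring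
          _ ≤ (1 / 2) ^ n * #(C (e t')) := by gcongr
          _ ≤ _ := h2

end Targets

/-! ### Coherent bigraphs -/

/-- `G` is a sparse bipartite graph with sides `S false` and `S true` in which every linear-sized
subset of one side has edges to every subset of the other side whose size is at least the power
`1 - c` of that side. This is what a counterexample to the theorem looks like. -/
structure Coherent {V : Type*} (G : SimpleGraph V) (S : Bool → Finset V) (ε c : ℝ) : Prop where
  bipartite : ∀ s, Anti G (S s) (S s)
  large : ∀ s, 1 ≤ ε * #(S s)
  sparse : ∀ s, ∀ v ∈ S s, (#(nbr G v (S (!s))) : ℝ) ≤ ε * #(S (!s))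
  expand : ∀ s, ∀ A ⊆ S s, ∀ B ⊆ S (!s), ε * #(S s) ≤ #A →
    ε * (#(S (!s)) : ℝ) ^ (1 - c) ≤ #B → ¬ Anti G A B

theorem Coherent.mono {V : Type*} {G : SimpleGraph V} {S : Bool → Finset V} {ε ε' c : ℝ}
    (h : Coherent G S ε c) (hε : ε ≤ ε') : Coherent G S ε' c where
  bipartite := h.bipartite
  large s := (h.large s).trans (by gcongr)
  sparse s v hv := (h.sparse s v hv).trans (by gcongr)
  expand s A hA B hB h1 h2 := h.expand s A hA B hB (le_trans (by gcongr) h1)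
    (le_trans (by gcongr) h2)

section Step

variable {V : Type*} {G : SimpleGraph V}

/-- The vertices of `L` that see more than a small proportion of one of the sets `Z j` are few. -/
theorem exists_light_subset {J : Type*} [Fintype J] {S : Bool → Finset V} {ε c κ θ : ℝ} {s : Bool}
    (hG : Coherent G S ε c) (hθ : 0 < θ) (hε : Fintype.card J * ε ≤ θ * (κ / 2))
    (L : Finset V) (Z : J → Finset V) (hL : L ⊆ S (!s)) (hLc : κ * #(S (!s)) ≤ #L)
    (hZ : ∀ j, Z j ⊆ S s) (hZ0 : ∀ j, (Z j).Nonempty) :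
    ∃ L' ⊆ L, κ / 2 * #(S (!s)) ≤ #L' ∧ ∀ j, ∀ a ∈ L', (#(nbr G a (Z j)) : ℝ) ≤ θ * #(Z j) := by
  classical
  set n : ℝ := (#(S (!s)) : ℝ) with hn
  let bad : J → Finset V := fun j => L.filter fun a => θ * #(Z j) < (#(nbr G a (Z j)) : ℝ)
  have hbad : ∀ j, θ * (#(bad j) : ℝ) ≤ ε * n := by
    intro j
    have hpos : (0 : ℝ) < #(Z j) := by exact_mod_cast (hZ0 j).card_pos
    have := card_heavy_le (G := G) (A := Z j) (B := L) (D := bad j) (d := ε * n) (τ := θ)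
      (fun z hz => le_trans (by exact_mod_cast card_le_card (nbr_mono hL))
        (hG.sparse s z (hZ j hz))) (filter_subset _ _) (fun b hb => (mem_filter.1 hb).2)
    have h2 : θ * (#(bad j) : ℝ) * #(Z j) ≤ ε * n * #(Z j) := by linarith
    exact le_of_mul_le_mul_right h2 hpos
  refine ⟨L.filter fun a => ∀ j, (#(nbr G a (Z j)) : ℝ) ≤ θ * #(Z j), filter_subset _ _, ?_,
    fun j a ha => (mem_filter.1 ha).2 j⟩
  have hsub : L ⊆ (L.filter fun a => ∀ j, (#(nbr G a (Z j)) : ℝ) ≤ θ * #(Z j)) ∪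
      univ.biUnion bad := by
    intro a ha
    by_cases h : ∀ j, (#(nbr G a (Z j)) : ℝ) ≤ θ * #(Z j)
    · exact mem_union_left _ (mem_filter.2 ⟨ha, h⟩)
    · push Not at h
      obtain ⟨j, hj⟩ := h
      exact mem_union_right _ (mem_biUnion.2 ⟨j, mem_univ j, mem_filter.2 ⟨ha, hj⟩⟩)
  have h1 : (#L : ℝ) ≤ #(L.filter fun a => ∀ j, (#(nbr G a (Z j)) : ℝ) ≤ θ * #(Z j)) +
      ∑ j, (#(bad j) : ℝ) := by
    exact_mod_cast (card_le_card hsub).trans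
      ((card_union_le _ _).trans (Nat.add_le_add_left card_biUnion_le _))
  have h2 : θ * ∑ j, (#(bad j) : ℝ) ≤ Fintype.card J * (ε * n) := by
    rw [mul_sum]
    refine (sum_le_sum fun j _ => hbad j).trans ?_
    simp
  have h3 : Fintype.card J * (ε * n) ≤ θ * (κ / 2 * n) := by
    have : (0 : ℝ) ≤ n := by positivity
    nlinarith
  have h4 : ∑ j, (#(bad j) : ℝ) ≤ κ / 2 * n := le_of_mul_le_mul_left (h2.trans h3) hθ
  linarith

/-- In a coherent bigraph, every linear-sized set contains a vertex whose number of neighbours in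
`B` is not too small, even if `B` is a polynomially small set. -/
theorem Coherent.exists_high_degree {S : Bool → Finset V} {ε c θ : ℝ} {s : Bool}
    (hG : Coherent G S ε c) {A B : Finset V} {z : ℝ} (hA : A ⊆ S (!s)) (hB : B ⊆ S s)
    (hε0 : 0 < ε) (hε : ε ≤ θ / 2)
    (hAc : ε * #(S (!s)) ≤ #A) (hBc : ε * (#(S s) : ℝ) ^ (1 - c) ≤ #B / 2) (hzB : θ * z ≤ #B)
    (hz : 0 ≤ z) :
    ∃ a ∈ A, z / (#(S (!s)) : ℝ) ^ 2 < #(nbr G a B) := by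
  by_contra! hcon
  set n : ℝ := (#(S (!s)) : ℝ) with hn
  have hn0 : 1 ≤ ε * n := hG.large _
  have hnpos : 0 < n := by
    by_contra! h
    nlinarith
  have hθ0 : 0 < θ := by linarith
  have h1 : (#(covered G A B) : ℝ) ≤ ∑ a ∈ A, (#(nbr G a B) : ℝ) := by
    classical
    have : covered G A B ⊆ A.biUnion fun a => nbr G a B := by
      intro b hb
      obtain ⟨hbB, a, ha, hab⟩ := mem_covered.1 hb
      exact mem_biUnion.2 ⟨a, ha, mem_nbr.2 ⟨hbB, hab.symm⟩⟩
    exact_mod_cast (card_le_card this).trans card_biUnion_le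
  have h2 : ∑ a ∈ A, (#(nbr G a B) : ℝ) ≤ n * (z / n ^ 2) := by
    refine (sum_le_sum hcon).trans ?_
    rw [sum_const, nsmul_eq_mul]
    have : (#A : ℝ) ≤ n := by
      rw [hn]
      exact_mod_cast card_le_card hA
    gcongr
  have h3 : n * (z / n ^ 2) ≤ #B / 2 := by
    have h4 : n * (z / n ^ 2) = z / n := by field_simp
    rw [h4, div_le_iff₀ hnpos]
    have h5 : 1 ≤ θ / 2 * n := hn0.trans (by gcongr)
    have h6 : z * 1 ≤ z * (θ / 2 * n) := by gcongr
    nlinarith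
  have h4 : (#(covered G A B) : ℝ) + #(uncovered G A B) = #B := by
    exact_mod_cast card_covered_add_card_uncovered (G := G) A B
  refine hG.expand (!s) A hA (uncovered G A B) (by simpa using (uncovered_subset A B).trans hB) hAc
    (by rw [Bool.not_not]; linarith) ?_
  exact Anti.symm fun b hb a ha => (mem_uncovered.1 hb).2 a ha

/-- One level of the construction of the tree, with explicit constants: `n ^ δ` is the ratio of the
logarithmic scale for degrees, `q` the number of its steps, and `θ` bounds the losses in
regularising. The sets that are to be protected are indexed by `Fin M' ⊕ Fin M' × ι`, the left part
for the linear-sized sets that are kept and the right part for the new polynomially small sets. -/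
theorem Coherent.exists_next_level {c κ δ η σ θ m ε κ' : ℝ} {M M' N j q : ℕ}
    {ι : Type} [Fintype ι] (hc : 0 < c) (hκ : 0 < κ) (hM' : 0 < M') (hδ0 : 0 < δ)
    (hδq : 2 ≤ δ * q) (hδM : δ * M ≤ c / 2) (hq0 : 0 < q) (hj : j = M * (M' * Fintype.card ι))
    (hN : N = q ^ j * M') (hη0 : 0 < η) (hη2 : η ≤ 1 / 2) (hMη : M * η ≤ (1 / 2) ^ (j + 1))
    (hθ : θ = η ^ (N * j * q)) (hm : m = Fintype.card (Fin M' ⊕ Fin M' × ι)) (hm1 : 1 ≤ m)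
    (hσ0 : 0 < σ) (hσm : m * σ ≤ (1 / 2) ^ (M + 3)) (hε0 : 0 < ε)
    (hε1 : (j + 1) * ε ≤ σ * θ * (κ / 2)) (hε2 : ε ≤ θ * (κ / 2)) (hε3 : ε ≤ θ / 2)
    (hκ' : κ' = (1 / 2) ^ j * (1 / 2 * (1 / (16 * m)) ^ M * (θ * (κ / 2))))
    {S : Bool → Finset V} (hG : Coherent G S ε c) (s : Bool) {ξ υ : Type} [Fintype ξ] [Fintype υ]
    (hξ : Fintype.card ξ = M) (hυ : Fintype.card υ = N) (L : υ → Finset V)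
    (Z : ξ → Fin M' × ι → Finset V) (hL : ∀ y, L y ⊆ S (!s)) (hLc : ∀ y, κ * #(S (!s)) ≤ #(L y))
    (hZ : ∀ x a, Z x a ⊆ S s) (hZc : ∀ x a, κ * (#(S s) : ℝ) ^ (1 - c / 2) ≤ #(Z x a)) :
    ∃ (p : Fin M' ↪ υ) (C : Fin M' → Finset V) (A : Fin M' × ι → Finset V)
      (X : Fin M' × ι → ξ → Finset V),
      (∀ i, C i ⊆ L (p i)) ∧ (∀ i, κ' * #(S (!s)) ≤ #(C i)) ∧
      (∀ t, A t ⊆ L (p t.1)) ∧ (∀ t, κ' * (#(S (!s)) : ℝ) ^ (1 - c / 2) ≤ #(A t)) ∧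
      (∀ t x, X t x ⊆ Z x t) ∧ (∀ i t x, Anti G (C i) (X t x)) ∧
      (∀ t t' x, t ≠ t' → Anti G (A t) (X t' x)) ∧
      ∀ t, ∀ a ∈ A t, ∀ x, ∃ b ∈ X t x, G.Adj a b := by
  classical
  have hθ0 : 0 < θ := by rw [hθ]; positivity
  have hθ1 : θ ≤ 1 := by rw [hθ]; exact pow_le_one₀ hη0.le (by linarith)
  set n : ℝ := (#(S (!s)) : ℝ) with hn
  have hnε : 1 ≤ ε * n := hG.large _
  have hn1 : 1 ≤ n := by
    have : ε ≤ 1 := by linarith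
    have hnn : 0 ≤ n := by positivity
    nlinarith
  have hs1 : (1 : ℝ) ≤ #(S s) := by
    have h1 := hG.large s
    have : ε ≤ 1 := by linarith
    have hnn : (0 : ℝ) ≤ #(S s) := by positivity
    nlinarith
  set Δ : ℝ := n ^ δ with hΔ
  have hΔ1 : 1 ≤ Δ := Real.one_le_rpow hn1 hδ0.le
  have hΔq : n ^ 2 ≤ Δ ^ q := by
    rw [hΔ, ← Real.rpow_natCast (n ^ δ), ← Real.rpow_mul (by linarith), ← Real.rpow_natCast]
    refine Real.rpow_le_rpow_of_exponent_le hn1 ?_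
    push_cast
    exact hδq
  have hΔM : Δ ^ M ≤ n ^ (c / 2) := by
    rw [hΔ, ← Real.rpow_natCast (n ^ δ), ← Real.rpow_mul (by linarith)]
    exact Real.rpow_le_rpow_of_exponent_le hn1 hδM
  let Z' : ξ × (Fin M' × ι) → Finset V := fun k => Z k.1 k.2
  have hJ : Fintype.card (ξ × (Fin M' × ι)) = j := by
    rw [Fintype.card_prod, Fintype.card_prod, Fintype.card_fin, hξ, hj]
  have hZ'S : ∀ k, Z' k ⊆ S s := fun k => hZ _ _
  have hZ'c : ∀ k, κ * (#(S s) : ℝ) ^ (1 - c) ≤ #(Z' k) := fun k => by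
    refine le_trans ?_ (hZc k.1 k.2)
    have := Real.rpow_le_rpow_of_exponent_le hs1 (show 1 - c ≤ 1 - c / 2 by linarith)
    gcongr
  have hZ'ne : ∀ k, (Z' k).Nonempty := fun k => by
    have h1 := hZ'c k
    have h2 : 0 < κ * (#(S s) : ℝ) ^ (1 - c) := by positivity
    rw [← card_pos]
    exact_mod_cast h2.trans_le h1
  have hlight := fun y => exists_light_subset (θ := σ * θ) hG (by positivity)
    (by
      rw [hJ]
      linarith)
    (L y) Z' (hL y) (hLc y) hZ'S hZ'ne
  choose L₁ hL₁ hL₁c hL₁d using hlight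
  have hcardp : Fintype.card (υ × (ξ × (Fin M' × ι))) * q = N * j * q := by
    rw [Fintype.card_prod, hJ, hυ]
  obtain ⟨A, B, sc, hA, hB, hsc, hAc, hBc, hup, hreg⟩ :=
    exists_regular (G := G) L₁ Z' hη0 hη2 hΔ1 (q := q) (by
      intro y k A hA B hB hAc hBc
      rw [hcardp, ← hθ] at hAc hBc
      obtain ⟨a, ha, hlt⟩ := hG.exists_high_degree (θ := θ) (z := #(Z' k))
        ((hA.trans (hL₁ y)).trans (hL y)) (hB.trans (hZ'S k)) hε0 hε3
        (le_trans (by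
          have := hL₁c y
          calc ε * n ≤ θ * (κ / 2) * n := by gcongr
            _ = θ * (κ / 2 * n) := by ring
            _ ≤ θ * #(L₁ y) := by gcongr) hAc)
        (by
          have h1 := hZ'c k
          have h2 : θ * (κ * (#(S s) : ℝ) ^ (1 - c)) ≤ θ * #(Z' k) := by gcongr
          have h3 : ε * (#(S s) : ℝ) ^ (1 - c) ≤ θ * (κ / 2) * (#(S s) : ℝ) ^ (1 - c) := by gcongr
          linarith) hBc (by positivity)
      refine ⟨a, ha, lt_of_le_of_lt ?_ hlt⟩
      gcongr)
  rw [hcardp, ← hθ] at hAc hBc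
  -- many of the sets `A y` have the same degrees, on the logarithmic scale
  have : Nonempty (Fin q) := ⟨⟨0, hq0⟩⟩
  obtain ⟨f, hf⟩ := Fintype.exists_le_card_fiber_of_mul_le_card
    (fun (y : υ) (k : ξ × (Fin M' × ι)) => (⟨sc y k, hsc y k⟩ : Fin q)) (n := M')
    (by rw [Fintype.card_fun, hJ, Fintype.card_fin, hυ, hN])
  obtain ⟨P, hPsub, hPc⟩ := exists_subset_card_eq hf
  let p : Fin M' ↪ υ := ((P.equivFinOfCardEq hPc).symm.toEmbedding).trans
    (Function.Embedding.subtype _)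
  have hp : ∀ i k, sc (p i) k = f k := by
    intro i k
    have h1 : p i ∈ P := ((P.equivFinOfCardEq hPc).symm i).2
    have h2 := congrFun (mem_filter.1 (hPsub h1)).2 k
    exact congrArg Fin.val h2
  let pos : Fin M' ⊕ Fin M' × ι → Fin M' := Sum.elim id Prod.fst
  have : Nonempty (Fin M' ⊕ Fin M' × ι) := ⟨Sum.inl ⟨0, hM'⟩⟩
  obtain ⟨X, C, hXB, hCA, hanti, hcov, hsz, hsz'⟩ :=
    exists_covered_targets (G := G) (I := Fin M' ⊕ Fin M' × ι) (τ := Fin M' × ι) (ξ := ξ)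
      Sum.inr Sum.inr_injective (fun i => A (p (pos i))) (fun t x => B (x, t))
      (fun t x => #(Z' (x, t)) / Δ ^ (f (x, t) : ℕ)) (η := η) (σ := σ) hΔ1 hσ0.le
      (fun t x => div_pos (by exact_mod_cast (hZ'ne _).card_pos) (by positivity))
      (fun t x i a ha => by
        have := hup (p (pos i)) (x, t) a ha
        rwa [hp] at this)
      (fun t x i a ha => by
        have h1 := hL₁d _ (x, t) a (hA _ ha)
        have h2 : (#(nbr G a (B (x, t))) : ℝ) ≤ #(nbr G a (Z' (x, t))) := by
          exact_mod_cast card_le_card (nbr_mono (hB _))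
        calc _ ≤ σ * θ * #(Z' (x, t)) := h2.trans h1
          _ = σ * (θ * #(Z' (x, t))) := by ring
          _ ≤ _ := by gcongr; exact hBc _)
      (by rw [← hm, hξ]; exact hσm)
      (fun t x B' hB' hB'c => by
        have := hreg (p t.1) (x, t) B' hB' hB'c
        rw [hp, pow_succ, ← div_div] at this
        exact this)
      (by rw [hξ, Fintype.card_prod, Fintype.card_fin, ← hj]; exact hMη)
  have hAn : ∀ y, θ * (κ / 2) * n ≤ #(A y) := fun y => by
    refine le_trans ?_ (hAc y)
    rw [mul_assoc]
    gcongr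
    exact hL₁c y
  rw [← hm, hξ, Fintype.card_prod, Fintype.card_fin, ← hj] at hsz'
  rw [hξ, Fintype.card_prod, Fintype.card_fin, ← hj] at hsz
  have hnn : n ^ (1 - c / 2) * Δ ^ M ≤ n := by
    calc n ^ (1 - c / 2) * Δ ^ M ≤ n ^ (1 - c / 2) * n ^ (c / 2) := by gcongr
      _ = n := by
        rw [← Real.rpow_add (by linarith)]
        simp
  refine ⟨p, fun i => C (Sum.inl i), fun t => C (Sum.inr t), X, fun i => ?_, fun i => ?_,
    fun t => ?_, fun t => ?_, fun t x => (hXB t x).trans (hB _), fun i t x => ?_,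
    fun t t' x htt' => ?_, hcov⟩
  · exact (hCA _).trans ((hA _).trans (hL₁ _))
  · refine le_trans ?_ (hsz (Sum.inl i) (by simp))
    have h1 := hAn (p (pos (Sum.inl i)))
    have h2 : 1 / 2 * (1 / (16 * m)) ^ M ≤ 1 := by
      have h3 : (1 / (16 * m)) ^ M ≤ 1 := pow_le_one₀ (by positivity) (by
        rw [div_le_one (by positivity)]; linarith)
      linarith
    calc κ' * n = (1 / 2) ^ (j) *
          ((1 / 2 * (1 / (16 * m)) ^ M) * (θ * (κ / 2) * n)) := by rw [hκ']; ring
      _ ≤ (1 / 2) ^ (j) * (1 * (θ * (κ / 2) * n)) := by gcongr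
      _ ≤ _ := by rw [one_mul]; gcongr
  · exact (hCA _).trans ((hA _).trans (hL₁ _))
  · refine le_trans ?_ (hsz' t)
    have h1 := hAn (p (pos (Sum.inr t)))
    calc κ' * n ^ (1 - c / 2) = (1 / 2) ^ (j) *
          (1 / 2 * (1 / (16 * m * Δ)) ^ M * (θ * (κ / 2) * (n ^ (1 - c / 2) * Δ ^ M))) := by
            have h2 : (1 / (16 * m * Δ)) ^ M = (1 / (16 * m)) ^ M / Δ ^ M := by
              rw [← div_pow, div_div]
            rw [hκ', h2]
            field_simp
      _ ≤ (1 / 2) ^ (j) *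
          (1 / 2 * (1 / (16 * m * Δ)) ^ M * (θ * (κ / 2) * n)) := by gcongr
      _ ≤ _ := by gcongr
  · exact hanti t x (Sum.inl i) (by simp)
  · exact hanti t' x (Sum.inr t) (by simpa using htt')

/-- From linear-sized sets `L y` on one side and polynomially small sets `Z x a` on the other side,
one finds `M'` indices `y` and, for each of them, a linear-sized subset `C` of `L y` and polynomially
small subsets `A` of `L y`. Every vertex of each `A t` has a neighbour in each of the sets
`X t x ⊆ Z x t`, and otherwise the sets `C i` and `A t` see none of the sets `X t x`. The number `N`
of sets `L y` that is needed does not depend on `κ`, so that the numbers of positions of all levels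
can be chosen before the constants. -/
theorem exists_next_level_constants {c : ℝ} (hc : 0 < c) (M M' : ℕ) (hM' : 0 < M')
    (ι : Type) [Fintype ι] :
    ∃ N : ℕ, 0 < N ∧ ∀ κ : ℝ, 0 < κ → ∃ κ' ε : ℝ, 0 < κ' ∧ 0 < ε ∧ ∀ {V : Type*} (G : SimpleGraph V)
      (S : Bool → Finset V), Coherent G S ε c → ∀ (s : Bool) (ξ υ : Type) [Fintype ξ] [Fintype υ],
      Fintype.card ξ = M → Fintype.card υ = N → ∀ (L : υ → Finset V)
      (Z : ξ → Fin M' × ι → Finset V), (∀ y, L y ⊆ S (!s)) → (∀ y, κ * #(S (!s)) ≤ #(L y)) →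
      (∀ x a, Z x a ⊆ S s) → (∀ x a, κ * (#(S s) : ℝ) ^ (1 - c / 2) ≤ #(Z x a)) →
      ∃ (p : Fin M' ↪ υ) (C : Fin M' → Finset V) (A : Fin M' × ι → Finset V)
        (X : Fin M' × ι → ξ → Finset V),
        (∀ i, C i ⊆ L (p i)) ∧ (∀ i, κ' * #(S (!s)) ≤ #(C i)) ∧
        (∀ t, A t ⊆ L (p t.1)) ∧ (∀ t, κ' * (#(S (!s)) : ℝ) ^ (1 - c / 2) ≤ #(A t)) ∧
        (∀ t x, X t x ⊆ Z x t) ∧ (∀ i t x, Anti G (C i) (X t x)) ∧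
        (∀ t t' x, t ≠ t' → Anti G (A t) (X t' x)) ∧
        ∀ t, ∀ a ∈ A t, ∀ x, ∃ b ∈ X t x, G.Adj a b := by
  -- each new set is covered from `M` positions, at the cost of a factor `n ^ δ` each time
  set δ : ℝ := c / (2 * (M + 1)) with hδ
  have hδ0 : 0 < δ := by positivity
  -- the relevant degrees differ by a factor of at most `n ^ 2 ≤ (n ^ δ) ^ q`
  set q : ℕ := ⌈2 / δ⌉₊ with hq
  have hδq : 2 ≤ δ * q := by
    have := Nat.le_ceil (2 / δ)
    rw [div_le_iff₀ hδ0] at this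
    linarith
  have hq0 : 0 < q := Nat.ceil_pos.2 (by positivity)
  have hδM : δ * M ≤ c / 2 := by
    rw [hδ, div_mul_eq_mul_div, div_le_div_iff₀ (by positivity) (by norm_num)]
    nlinarith
  obtain ⟨j, hj⟩ : ∃ j : ℕ, j = M * (M' * Fintype.card ι) := ⟨_, rfl⟩
  obtain ⟨η, hη⟩ : ∃ η : ℝ, η = (1 / 2) ^ (j + 1) / (M + 1) := ⟨_, rfl⟩
  have hη0 : 0 < η := by rw [hη]; positivity
  have hη2 : η ≤ 1 / 2 := by
    have h1 : (1 / 2 : ℝ) ^ (j + 1) ≤ (1 / 2) ^ 1 :=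
      pow_le_pow_of_le_one (by norm_num) (by norm_num) (by omega)
    rw [hη]
    refine (div_le_self (by positivity) ?_).trans (by simpa using h1)
    have : (0 : ℝ) ≤ M := by positivity
    linarith
  have hMη : M * η ≤ (1 / 2) ^ (j + 1) := by
    rw [hη, mul_div_assoc', div_le_iff₀ (by positivity)]
    have : (0 : ℝ) ≤ (1 / 2) ^ (j + 1) := by positivity
    nlinarith
  -- there are `q ^ j` patterns of degrees from one `L y` to the `j` sets `Z x a`
  obtain ⟨N, hN⟩ : ∃ N : ℕ, N = q ^ j * M' := ⟨_, rfl⟩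
  obtain ⟨θ, hθ⟩ : ∃ θ : ℝ, θ = η ^ (N * j * q) := ⟨_, rfl⟩
  have hθ0 : 0 < θ := by rw [hθ]; positivity
  obtain ⟨m, hm⟩ : ∃ m : ℝ, m = Fintype.card (Fin M' ⊕ Fin M' × ι) := ⟨_, rfl⟩
  have hm1 : 1 ≤ m := by
    rw [hm, Fintype.card_sum, Fintype.card_fin]
    exact_mod_cast (by omega : 1 ≤ M' + _)
  obtain ⟨σ, hσ⟩ : ∃ σ : ℝ, σ = (1 / 2) ^ (M + 3) / m := ⟨_, rfl⟩
  have hσ0 : 0 < σ := by rw [hσ]; positivity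
  refine ⟨N, by rw [hN]; exact Nat.mul_pos (pow_pos hq0 _) hM', fun κ hκ => ?_⟩
  obtain ⟨ε, hε⟩ : ∃ ε : ℝ,
      ε = min (σ * θ * (κ / 2) / (j + 1)) (min (θ * (κ / 2)) (θ / 2)) := ⟨_, rfl⟩
  have hε0 : 0 < ε := by rw [hε]; positivity
  have hε1 : (j + 1) * ε ≤ σ * θ * (κ / 2) := by
    have : ε ≤ σ * θ * (κ / 2) / (j + 1) := hε.le.trans (min_le_left _ _)
    rw [le_div_iff₀ (by positivity)] at this
    linarith
  refine ⟨(1 / 2) ^ j * (1 / 2 * (1 / (16 * m)) ^ M * (θ * (κ / 2))), ε, by positivity, hε0, ?_⟩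
  intro V G S hG s ξ υ _ _ hξ hυ L Z hL hLc hZ hZc
  exact hG.exists_next_level hc hκ hM' hδ0 hδq hδM hq0 hj hN hη0 hη2
    hMη hθ hm hm1 hσ0 (by rw [hσ]; apply le_of_eq; field_simp) hε0 hε1
    (hε.le.trans ((min_le_right _ _).trans (min_le_left _ _)))
    (hε.le.trans ((min_le_right _ _).trans (min_le_right _ _))) rfl s hξ hυ L Z hL hLc hZ hZc

end Step

/-! ### Rooted trees and their copies -/

section Tree

variable {W : Type*} {V : Type*}

/-- A tree `T` with two sides, described by its root, the parent of each vertex and the distance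
`lev` of each vertex from the root (the parent of the root is irrelevant). -/
structure IsRooted (T : SimpleGraph W) (side : W → Bool) (root : W) (par : W → W) (lev : W → ℕ) :
    Prop where
  adj_iff : ∀ u w, T.Adj u w ↔ (lev w = lev u + 1 ∧ par w = u) ∨ (lev u = lev w + 1 ∧ par u = w)
  lev_par : ∀ w, lev w ≠ 0 → lev (par w) + 1 = lev w
  lev_root : lev root = 0
  eq_root : ∀ w, lev w = 0 → w = root
  side_eq : ∀ w, side w = xor (side root) (lev w).bodd

/-- `w` is a descendant of `v`, possibly `v` itself. -/
def IsDesc (par : W → W) (lev : W → ℕ) (v w : W) : Prop :=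
  ∃ i, lev w = lev v + i ∧ par^[i] w = v

/-- `u` is a child of `v`. -/
def IsChild (par : W → W) (lev : W → ℕ) (v u : W) : Prop :=
  lev u = lev v + 1 ∧ par u = v

/-- The child of `v` on the path to its descendant `w`, for `w ≠ v`. -/
def towards (par : W → W) (lev : W → ℕ) (v w : W) : W :=
  par^[lev w - lev v - 1] w

variable {T : SimpleGraph W} {side : W → Bool} {root : W} {par : W → W} {lev : W → ℕ}

theorem isDesc_refl (v : W) : IsDesc par lev v v := ⟨0, rfl, rfl⟩

theorem IsDesc.of_isChild {u w w' : W} (h : IsDesc par lev u w) (hw : IsChild par lev w w') :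
    IsDesc par lev u w' := by
  obtain ⟨i, hi, hi'⟩ := h
  refine ⟨i + 1, by rw [hw.1, hi, add_assoc], ?_⟩
  rw [Function.iterate_succ_apply, hw.2, hi']

theorem IsRooted.lev_iterate (hT : IsRooted T side root par lev) (w : W) :
    ∀ i ≤ lev w, lev (par^[i] w) + i = lev w := by
  intro i
  induction i with
  | zero => simp
  | succ i ih =>
    intro hi
    have h1 := ih (by omega)
    have h2 := hT.lev_par (par^[i] w) (by omega)
    rw [Function.iterate_succ_apply']
    omega

theorem IsRooted.isDesc_root (hT : IsRooted T side root par lev) (w : W) :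
    IsDesc par lev root w := by
  refine ⟨lev w, by rw [hT.lev_root, zero_add], hT.eq_root _ ?_⟩
  have := hT.lev_iterate w (lev w) le_rfl
  omega

theorem IsRooted.towards_spec (hT : IsRooted T side root par lev) {v w : W}
    (h : IsDesc par lev v w) (hne : w ≠ v) :
    IsChild par lev v (towards par lev v w) ∧ IsDesc par lev (towards par lev v w) w := by
  obtain ⟨i, hi, hi'⟩ := h
  rcases i with _ | i
  · exact absurd hi' hne
  have hw : lev w - lev v - 1 = i := by omega
  have hlev := hT.lev_iterate w i (by omega)
  rw [towards, hw]
  refine ⟨⟨by omega, ?_⟩, i, by omega, rfl⟩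
  rw [← Function.iterate_succ_apply' par, hi']

theorem eq_towards {v u w : W} (hu : IsChild par lev v u) (h : IsDesc par lev u w) :
    u = towards par lev v w := by
  obtain ⟨i, hi, hi'⟩ := h
  have := hu.1
  rw [towards, show lev w - lev v - 1 = i by omega, hi']

theorem IsRooted.side_of_isChild (hT : IsRooted T side root par lev) {v u : W}
    (h : IsChild par lev v u) : side u = !side v := by
  rw [hT.side_eq u, hT.side_eq v, h.1, Nat.bodd_succ]
  simp

/-- `z` is the root of an induced copy of the subtree of `T` at `v`, whose other vertices lie in
`U`, and in which each vertex `w` lies in the block prescribed by `φ w`. -/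
def HasCopy (G : SimpleGraph V) (Blk : Bool → ℕ → Finset V) (T : SimpleGraph W) (side : W → Bool)
    (par : W → W) (lev : W → ℕ) (φ : W → ℕ) (v : W) (z : V) (U : Finset V) : Prop :=
  ∃ f : W → V, f v = z ∧ (∀ w, IsDesc par lev v w → w ≠ v → f w ∈ U) ∧
    (∀ w, IsDesc par lev v w → f w ∈ Blk (side w) (φ w)) ∧
    ∀ w w', IsDesc par lev v w → IsDesc par lev v w' → (G.Adj (f w) (f w') ↔ T.Adj w w')

/-- Copies of the subtrees at the children of `v` that do not interfere with each other, together
with a vertex `r` that sees only their roots, form a copy of the subtree at `v`. -/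
theorem IsRooted.hasCopy_of_children (hT : IsRooted T side root par lev) {G : SimpleGraph V}
    {Blk : Bool → ℕ → Finset V} {φ : W → ℕ} {v : W} {r : V} (hr : r ∈ Blk (side v) (φ v))
    (z : W → V) (U : W → Finset V) {U' : Finset V}
    (hcopy : ∀ u, IsChild par lev v u → HasCopy G Blk T side par lev φ u (z u) (U u))
    (hz : ∀ u, IsChild par lev v u → z u ∈ U') (hU : ∀ u, IsChild par lev v u → U u ⊆ U')
    (hadj : ∀ u, IsChild par lev v u → G.Adj r (z u))
    (hrU : ∀ u, IsChild par lev v u → ∀ b ∈ U u, ¬ G.Adj r b)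
    (hUU : ∀ u u', IsChild par lev v u → IsChild par lev v u' → u ≠ u' → Anti G (U u) (U u'))
    (hUz : ∀ u u', IsChild par lev v u → IsChild par lev v u' → u ≠ u' →
      ∀ b ∈ U u, ¬ G.Adj b (z u'))
    (hzz : ∀ u u', IsChild par lev v u → IsChild par lev v u' → u ≠ u' → ¬ G.Adj (z u) (z u')) :
    HasCopy G Blk T side par lev φ v r U' := by
  classical
  have : Nonempty V := ⟨r⟩
  choose! f hfz hfU hfB hfA using hcopy
  have hroot : ∀ w, IsChild par lev v (towards par lev v w) → w = towards par lev v w →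
      f (towards par lev v w) w = z (towards par lev v w) := by
    intro w h1 h
    have h3 := hfz _ h1
    rwa [← h] at h3 ⊢
  have hF : ∀ w, IsDesc par lev v w → w ≠ v → f (towards par lev v w) w ∈ U' := by
    intro w hw hne
    obtain ⟨h1, h2⟩ := hT.towards_spec hw hne
    by_cases h : w = towards par lev v w
    · rw [hroot w h1 h]
      exact hz _ h1
    · exact hU _ h1 (hfU _ h1 w h2 h)
  -- `r` sees the root of each of the copies and no other vertex of it
  have hrF : ∀ w, IsDesc par lev v w → w ≠ v →
      (G.Adj r (f (towards par lev v w) w) ↔ T.Adj v w) := by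
    intro w hw hne
    obtain ⟨h1, h2⟩ := hT.towards_spec hw hne
    by_cases h : w = towards par lev v w
    · rw [hroot w h1 h]
      rw [← h] at h1 ⊢
      exact ⟨fun _ => (hT.adj_iff v w).2 (Or.inl h1), fun _ => hadj w h1⟩
    · refine ⟨fun hcon => absurd hcon (hrU _ h1 _ (hfU _ h1 w h2 h)), fun hcon => absurd ?_ h⟩
      rcases (hT.adj_iff v w).1 hcon with h3 | h3
      · exact eq_towards h3 (isDesc_refl w)
      · obtain ⟨i, hi, _⟩ := hw
        omega
  refine ⟨fun w => if w = v then r else f (towards par lev v w) w, if_pos rfl, ?_, ?_, ?_⟩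
  · intro w hw hne
    beta_reduce
    rw [if_neg hne]
    exact hF w hw hne
  · intro w hw
    beta_reduce
    by_cases hne : w = v
    · subst hne
      rwa [if_pos rfl]
    · rw [if_neg hne]
      obtain ⟨h1, h2⟩ := hT.towards_spec hw hne
      exact hfB _ h1 w h2
  intro w w' hw hw'
  beta_reduce
  by_cases hwv : w = v <;> by_cases hwv' : w' = v
  · subst hwv hwv'
    simp
  · subst hwv
    rw [if_pos rfl, if_neg hwv']
    exact hrF w' hw' hwv'
  · subst hwv'
    rw [if_pos rfl, if_neg hwv, G.adj_comm, T.adj_comm]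
    exact hrF w hw hwv
  rw [if_neg hwv, if_neg hwv']
  obtain ⟨h1, h2⟩ := hT.towards_spec hw hwv
  obtain ⟨h1', h2'⟩ := hT.towards_spec hw' hwv'
  by_cases huu : towards par lev v w = towards par lev v w'
  · rw [← huu] at h2' ⊢
    exact hfA _ h1 w w' h2 h2'
  have hTadj : ¬ T.Adj w w' := by
    intro hcon
    rcases (hT.adj_iff w w').1 hcon with h3 | h3
    · exact huu (eq_towards h1 (h2.of_isChild h3))
    · exact huu (eq_towards h1' (h2'.of_isChild h3)).symm
  refine ⟨fun hcon => ?_, fun hcon => absurd hcon hTadj⟩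
  exfalso
  by_cases h : w = towards par lev v w
  · have h3 := hroot w h1 h
    by_cases h' : w' = towards par lev v w'
    · have h3' := hroot w' h1' h'
      rw [h3, h3'] at hcon
      exact hzz _ _ h1 h1' huu hcon
    · rw [h3] at hcon
      exact hUz _ _ h1' h1 (Ne.symm huu) _ (hfU _ h1' w' h2' h') hcon.symm
  · have hm := hfU _ h1 w h2 h
    by_cases h' : w' = towards par lev v w'
    · have h3' := hroot w' h1' h'
      rw [h3'] at hcon
      exact hUz _ _ h1 h1' huu _ hm hcon
    · exact hUU _ _ h1 h1' huu _ hm _ (hfU _ h1' w' h2' h') hcon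

end Tree

/-! ### Building the tree level by level -/

section Levels

variable {W : Type*} {V : Type*}

/-- Positions for the vertices of the tree: different vertices of one side get different positions,
which are among those allowed for that side. -/
def IsPlacement (side : W → Bool) (P : Bool → Finset ℕ) (φ : W → ℕ) : Prop :=
  (∀ w, φ w ∈ P (side w)) ∧ ∀ w w', side w = side w' → φ w = φ w' → w = w'

/-- The outcome of treating all levels of the tree from the deepest one up to level `k`, whose
vertices are on side `s`. The set `P t` consists of the positions still in use on side `t`. For each
of them a linear-sized part `L t i` of the block is reserved for the levels that are still to come.
For each position `i` on side `s` there are polynomially small sets `Z i a`, such that for every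
placement of the tree in the positions `P` and every vertex `v` of level `k` placed at `i`, each
vertex of `Z i a` is the root of a copy of the subtree at `v`. The vertices `U i a` of these copies
do not interfere with the other copies or with the reserved sets. The index `a` provides as many
disjoint copies as the remaining levels need. -/
def HasLevel (G : SimpleGraph V) (S : Bool → Finset V) (Blk : Bool → ℕ → Finset V)
    (T : SimpleGraph W) (side : W → Bool) (par : W → W) (lev : W → ℕ) (c κ : ℝ) (k : ℕ) (s : Bool)
    (P : Bool → Finset ℕ) (ι : Type) : Prop :=
  ∃ (L : Bool → ℕ → Finset V) (Z U : ℕ → ι → Finset V),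
    (∀ t, ∀ i ∈ P t, L t i ⊆ Blk t i) ∧ (∀ t, ∀ i ∈ P t, κ * #(S t) ≤ #(L t i)) ∧
    (∀ i ∈ P s, ∀ a, Z i a ⊆ Blk s i) ∧
    (∀ i ∈ P s, ∀ a, κ * (#(S s) : ℝ) ^ (1 - c / 2) ≤ #(Z i a)) ∧
    (∀ i ∈ P s, ∀ a, ∀ t, ∀ i' ∈ P t, Anti G (U i a) (L t i')) ∧
    (∀ i ∈ P s, ∀ a, ∀ i' ∈ P s, ∀ a', (i, a) ≠ (i', a') → Anti G (U i a) (U i' a')) ∧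
    (∀ i ∈ P s, ∀ a, ∀ i' ∈ P s, ∀ a', (i, a) ≠ (i', a') → Anti G (U i a) (Z i' a')) ∧
    ∀ i ∈ P s, ∀ a, ∀ z ∈ Z i a, ∀ v, lev v = k → ∀ φ, IsPlacement side P φ → φ v = i →
      HasCopy G Blk T side par lev φ v z (U i a)

variable {T : SimpleGraph W} {side : W → Bool} {root : W} {par : W → W} {lev : W → ℕ}

/-- The passage from level `k + 1` to level `k`. The positions on side `s` stay the same, while only
`M'` of those on side `!s` stay in use. Each copy for level `k` uses up the sets of level `k + 1`
with one and the same index, which is why that level is needed with the index set `Fin M' × ι`. -/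
theorem HasLevel.step (hT : IsRooted T side root par lev) {c : ℝ} (hc : 0 < c) (M M' : ℕ)
    (hM' : 0 < M') (ι : Type) [Fintype ι] :
    ∃ N : ℕ, 0 < N ∧ ∀ κ : ℝ, 0 < κ → ∃ κ' ε : ℝ, 0 < κ' ∧ 0 < ε ∧ ∀ {V : Type*} (G : SimpleGraph V)
      (S : Bool → Finset V) (Blk : Bool → ℕ → Finset V), Coherent G S ε c →
      (∀ t i, Blk t i ⊆ S t) → ∀ (k : ℕ) (s : Bool) (P : Bool → Finset ℕ),
      (∀ v, lev v = k → side v = !s) → #(P s) = M → #(P (!s)) = N →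
      HasLevel G S Blk T side par lev c κ (k + 1) s P (Fin M' × ι) →
      ∃ P' : Bool → Finset ℕ, #(P' s) = M ∧ #(P' (!s)) = M' ∧
        HasLevel G S Blk T side par lev c κ' k (!s) P' ι := by
  classical
  obtain ⟨N, hN, H⟩ := exists_next_level_constants hc M M' hM' ι
  refine ⟨N, hN, fun κ hκ => ?_⟩
  obtain ⟨κ₁, ε, hκ₁, hε, H⟩ := H κ hκ
  have : Nonempty (Fin M') := ⟨⟨0, hM'⟩⟩
  refine ⟨min κ κ₁, ε, lt_min hκ hκ₁, hε, ?_⟩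
  intro V G S Blk hG hBlk k s P hside hPs hPs' ⟨L, Z, U, hL, hLc, hZ, hZc, hUL, hUU, hUZ, hcopy⟩
  obtain ⟨p, C, A, X, hC, hCc, hA, hAc, hX, hCX, hAX, hcov⟩ :=
    H G S hG s (P s) (P (!s)) (by simpa using hPs) (by simpa using hPs') (fun y => L (!s) y)
      (fun x a => Z x a) (fun y => (hL _ _ y.2).trans (hBlk _ _)) (fun y => hLc _ _ y.2)
      (fun x a => (hZ _ x.2 a).trans (hBlk _ _)) (fun x a => hZc _ x.2 a)
  have hpinj : Function.Injective fun t => ((p t : P (!s)) : ℕ) :=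
    Subtype.val_injective.comp p.injective
  -- the new positions on side `!s`, and the index of each of them
  let Q : Finset ℕ := univ.image fun t => ((p t : P (!s)) : ℕ)
  let idx : ℕ → Fin M' := Function.invFun fun t => ((p t : P (!s)) : ℕ)
  have hidx : ∀ i ∈ Q, ((p (idx i) : P (!s)) : ℕ) = i := by
    intro i hi
    obtain ⟨t, _, rfl⟩ := mem_image.1 hi
    exact congrArg (fun t => ((p t : P (!s)) : ℕ)) (Function.leftInverse_invFun hpinj t)
  have hQ : ∀ i ∈ Q, i ∈ P (!s) := by
    intro i hi
    rw [← hidx i hi]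
    exact (p (idx i)).2
  have hne : ∀ i ∈ Q, ∀ i' ∈ Q, ∀ a a' : ι, (i, a) ≠ (i', a') → (idx i, a) ≠ (idx i', a') := by
    intro i hi i' hi' a a' h h'
    obtain ⟨h1, h2⟩ := Prod.mk.inj h'
    exact h (by rw [← hidx i hi, ← hidx i' hi', h1, h2])
  have hXS : ∀ t x, X t x ⊆ S s := fun t x => (hX t x).trans ((hZ _ x.2 _).trans (hBlk _ _))
  have hAL : ∀ i ∈ Q, ∀ a, A (idx i, a) ⊆ L (!s) i := by
    intro i hi a
    have := hA (idx i, a)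
    rwa [hidx i hi] at this
  have hCL : ∀ i ∈ Q, C (idx i) ⊆ L (!s) i := by
    intro i hi
    have := hC (idx i)
    rwa [hidx i hi] at this
  let P' : Bool → Finset ℕ := fun t => if t = s then P s else Q
  have hP's : P' s = P s := if_pos rfl
  have hP'n : P' (!s) = Q := if_neg (by simp)
  have hP'sub : ∀ t, P' t ⊆ P t := by
    intro t
    rcases Bool.eq_or_eq_not t s with rfl | rfl
    · rw [hP's]
    · rw [hP'n]; exact hQ
  let L' : Bool → ℕ → Finset V := fun t i => if t = s then L s i else C (idx i)
  have hL's : ∀ i, L' s i = L s i := fun i => if_pos rfl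
  have hL'n : ∀ i, L' (!s) i = C (idx i) := fun i => if_neg (by simp)
  let U' : ℕ → ι → Finset V := fun i a =>
    univ.biUnion fun x : P s => X (idx i, a) x ∪ U x (idx i, a)
  -- to see that `U' i a` has no edges to some set, treat the new and the old vertices separately
  have hU' : ∀ i a (D : Finset V), (∀ x, Anti G (X (idx i, a) x) D) →
      (∀ x : P s, Anti G (U x (idx i, a)) D) → Anti G (U' i a) D := by
    intro i a D h1 h2 b hb d hd
    obtain ⟨x, _, hx⟩ := mem_biUnion.1 hb
    rcases mem_union.1 hx with hx | hx
    · exact h1 x b hx d hd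
    · exact h2 x b hx d hd
  refine ⟨P', by rw [hP's, hPs], ?_, L', fun i a => A (idx i, a), U', ?_, ?_, ?_, ?_, ?_, ?_, ?_, ?_⟩
  · rw [hP'n, card_image_of_injective _ hpinj, card_univ, Fintype.card_fin]
  · intro t i hi
    rcases Bool.eq_or_eq_not t s with rfl | rfl
    · rw [hL's]
      exact hL _ _ (hP'sub _ hi)
    · rw [hP'n] at hi
      rw [hL'n]
      exact (hCL i hi).trans (hL _ _ (hQ i hi))
  · intro t i hi
    rcases Bool.eq_or_eq_not t s with rfl | rfl
    · rw [hL's]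
      refine le_trans ?_ (hLc _ _ (hP'sub _ hi))
      exact mul_le_mul_of_nonneg_right (min_le_left _ _) (Nat.cast_nonneg _)
    · rw [hL'n]
      refine le_trans ?_ (hCc (idx i))
      exact mul_le_mul_of_nonneg_right (min_le_right _ _) (Nat.cast_nonneg _)
  · intro i hi a
    rw [hP'n] at hi
    exact (hAL i hi a).trans (hL _ _ (hQ i hi))
  · intro i hi a
    refine le_trans ?_ (hAc (idx i, a))
    exact mul_le_mul_of_nonneg_right (min_le_right _ _) (Real.rpow_nonneg (Nat.cast_nonneg _) _)
  · intro i hi a t i' hi'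
    rcases Bool.eq_or_eq_not t s with rfl | rfl
    · rw [hL's]
      have hi'' := hP'sub _ hi'
      exact hU' i a _ (fun x => (hG.bipartite t).mono (hXS _ x) ((hL _ _ hi'').trans (hBlk _ _)))
        (fun x => hUL _ x.2 _ _ _ hi'')
    · rw [hL'n]
      rw [hP'n] at hi'
      exact hU' i a _ (fun x => (hCX _ _ _).symm)
        (fun x => (hUL _ x.2 _ _ _ (hQ i' hi')).mono (Subset.refl _) (hCL i' hi'))
  · intro i hi a i' hi' a' h
    rw [hP'n] at hi hi'
    have h' := hne i hi i' hi' a a' h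
    refine hU' i a _ (fun x => Anti.symm (hU' i' a' _ (fun x' => ?_) fun x' => ?_))
      (fun x => Anti.symm (hU' i' a' _ (fun x' => ?_) fun x' => ?_))
    · exact (hG.bipartite s).mono (hXS _ _) (hXS _ _)
    · exact (hUZ _ x'.2 _ _ x.2 _ (by simp [Ne.symm h'])).mono (Subset.refl _) (hX _ _)
    · exact ((hUZ _ x.2 _ _ x'.2 _ (by simp [h'])).mono (Subset.refl _) (hX _ _)).symm
    · exact hUU _ x'.2 _ _ x.2 _ (by simp [Ne.symm h'])
  · intro i hi a i' hi' a' h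
    rw [hP'n] at hi hi'
    have h' := hne i hi i' hi' a a' h
    exact hU' i a _ (fun x => (hAX _ _ x (Ne.symm h')).symm)
      (fun x => (hUL _ x.2 _ _ _ (hQ i' hi')).mono (Subset.refl _) (hAL i' hi' a'))
  · intro i hi a r hr v hv φ hφ hφv
    rw [hP'n] at hi
    have hrL := hAL i hi a hr
    have hφP : IsPlacement side P φ := ⟨fun w => hP'sub _ (hφ.1 w), hφ.2⟩
    have hsu : ∀ u, IsChild par lev v u → side u = s := fun u hu => by
      rw [hT.side_of_isChild hu, hside v hv, Bool.not_not]
    have hφu : ∀ u, IsChild par lev v u → φ u ∈ P s := fun u hu => by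
      have := hφP.1 u
      rwa [hsu u hu] at this
    have hz : ∀ u, ∃ z, ∀ hu : IsChild par lev v u,
        z ∈ X (idx i, a) ⟨φ u, hφu u hu⟩ ∧ G.Adj r z := by
      intro u
      by_cases hu : IsChild par lev v u
      · obtain ⟨z, hz, hrz⟩ := hcov _ r hr ⟨φ u, hφu u hu⟩
        exact ⟨z, fun _ => ⟨hz, hrz⟩⟩
      · exact ⟨r, fun h => absurd h hu⟩
    choose z hz using hz
    have hinj : ∀ u u', IsChild par lev v u → IsChild par lev v u' → u ≠ u' →
        (φ u, (idx i, a)) ≠ (φ u', (idx i, a)) := fun u u' hu hu' h h' =>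
      h (hφ.2 u u' ((hsu u hu).trans (hsu u' hu').symm) (Prod.mk.inj h').1)
    refine hT.hasCopy_of_children ?_ z (fun u => U (φ u) (idx i, a)) ?_ ?_ ?_ ?_ ?_ ?_ ?_ ?_
    · rw [hside v hv, hφv]
      exact hL _ _ (hQ i hi) hrL
    · intro u hu
      exact hcopy (φ u) (hφu u hu) (idx i, a) _ (hX _ _ (hz u hu).1) u (by rw [hu.1, hv]) φ hφP rfl
    · intro u hu
      exact mem_biUnion.2 ⟨⟨φ u, hφu u hu⟩, mem_univ _, mem_union_left _ (hz u hu).1⟩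
    · intro u hu b hb
      exact mem_biUnion.2 ⟨⟨φ u, hφu u hu⟩, mem_univ _, mem_union_right _ hb⟩
    · exact fun u hu => (hz u hu).2
    · intro u hu b hb hrb
      exact hUL _ (hφu u hu) _ _ _ (hQ i hi) b hb r hrL hrb.symm
    · intro u u' hu hu' h
      exact hUU _ (hφu u hu) _ _ (hφu u' hu') _ (hinj u u' hu hu' h)
    · intro u u' hu hu' h b hb
      exact hUZ _ (hφu u hu) _ _ (hφu u' hu') _ (hinj u u' hu hu' h) b hb _ (hX _ _ (hz u' hu').1)
    · intro u u' hu hu' _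
      exact hG.bipartite s _ (hXS _ _ (hz u hu).1) _ (hXS _ _ (hz u' hu').1)

/-- All levels of the tree, from the deepest one up to level `k`: for suitable constants, every
coherent bigraph with sufficiently many blocks of linear size has level `k`, with prescribed numbers
`M` and `M'` of positions. The proof is by induction on the number `d` of these levels. -/
theorem exists_hasLevel (hT : IsRooted T side root par lev) {c : ℝ} (hc : 0 < c) (h : ℕ)
    (hh : ∀ w, lev w < h) (d : ℕ) : ∀ (k : ℕ) (s : Bool), k + d = h →
    (∀ v, side v = xor s (xor (lev v).bodd k.bodd)) → ∀ (M M' : ℕ), 0 < M → 0 < M' →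
    ∀ (ι : Type) [Fintype ι],
    ∃ (K : ℕ) (κ ε : ℝ), 0 < K ∧ 0 < κ ∧ 0 < ε ∧ ∀ {V : Type*} (G : SimpleGraph V)
      (S : Bool → Finset V) (Blk : Bool → ℕ → Finset V), Coherent G S ε c →
      (∀ t i, Blk t i ⊆ S t) → (∀ t, ∀ i < K, (#(S t) : ℝ) / (2 * K) ≤ #(Blk t i)) →
      ∃ P : Bool → Finset ℕ, #(P s) = M ∧ #(P (!s)) = M' ∧
        HasLevel G S Blk T side par lev c κ k s P ι := by
  induction d with
  | zero =>
    intro k s hk _ M M' hM hM' ι _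
    refine ⟨M + M', 1 / (2 * (M + M' : ℕ)), 1, by omega, by positivity, one_pos, ?_⟩
    intro V G S Blk hG hBlk hBlkc
    have hlarge : ∀ t, (1 : ℝ) ≤ #(S t) := fun t => by simpa using hG.large t
    let P : Bool → Finset ℕ := fun t => if t = s then range M else range M'
    have hP : ∀ t, ∀ i ∈ P t, i < M + M' := by
      intro t i hi
      rcases Bool.eq_or_eq_not t s with rfl | rfl
      · have : i ∈ range M := by simpa [P] using hi
        rw [mem_range] at this; omega
      · have : i ∈ range M' := by simpa [P] using hi
        rw [mem_range] at this; omega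
    have hsize : ∀ t, ∀ i ∈ P t, 1 / (2 * (M + M' : ℕ)) * (#(S t) : ℝ) ≤ #(Blk t i) := by
      intro t i hi
      refine le_trans (le_of_eq ?_) (hBlkc t i (hP t i hi))
      ring
    refine ⟨P, by simp [P], by simp [P], Blk, fun i _ => Blk s i, fun _ _ => ∅,
      fun _ _ _ => Subset.refl _, hsize, fun _ _ _ => Subset.refl _, ?_, ?_, ?_, ?_, ?_⟩
    · intro i hi a
      refine le_trans ?_ (hsize s i hi)
      gcongr
      calc (#(S s) : ℝ) ^ (1 - c / 2) ≤ (#(S s) : ℝ) ^ (1 : ℝ) :=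
            Real.rpow_le_rpow_of_exponent_le (hlarge s) (by linarith)
        _ = _ := Real.rpow_one _
    · intro i _ a t i' _ b hb
      simp at hb
    · intro i _ a i' _ a' _ b hb
      simp at hb
    · intro i _ a i' _ a' _ b hb
      simp at hb
    · intro i hi a z hz v hv
      have := hh v
      omega
  | succ d ih =>
    intro k s hk hside M M' hM hM' ι _
    obtain ⟨N, hN, H⟩ := HasLevel.step (T := T) hT hc M' M hM ι
    obtain ⟨K, κ, ε₁, hK, hκ, hε₁, H₁⟩ := ih (k + 1) (!s) (by omega)
      (fun v => by rw [hside v, Nat.bodd_succ]; cases s <;> cases (lev v).bodd <;> simp)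
      M' N hM' hN (Fin M × ι)
    obtain ⟨κ', ε₂, hκ', hε₂, H₂⟩ := H κ hκ
    refine ⟨K, κ', min ε₁ ε₂, hK, hκ', lt_min hε₁ hε₂, ?_⟩
    intro V G S Blk hG hBlk hBlkc
    obtain ⟨P, hP, hP', hlev⟩ := H₁ G S Blk (hG.mono (min_le_left _ _)) hBlk hBlkc
    have := H₂ G S Blk (hG.mono (min_le_right _ _)) hBlk k (!s) P
      (fun v hv => by rw [hside v, hv, Bool.xor_self, Bool.xor_false, Bool.not_not]) hP hP' hlev
    rw [Bool.not_not] at this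
    obtain ⟨P', h1, h2, h3⟩ := this
    exact ⟨P', h2, h1, h3⟩

end Levels

/-! ### Rooting a tree, and dividing a linear order into blocks -/

open SimpleGraph in
theorem exists_isRooted {W : Type*} {T : SimpleGraph W} (hT : T.IsTree) {side : W → Bool}
    (hside : ∀ u w, T.Adj u w → side w = !side u) (r : W) :
    ∃ (par : W → W) (lev : W → ℕ), IsRooted T side r par lev := by
  choose p hp using fun w => hT.connected.exists_walk_length_eq_dist r w
  have hpath : ∀ w, (p w).IsPath := fun w => (p w).isPath_of_length_eq_dist (hp w)
  -- the shortest path to `w` passes through every neighbour of `w` that is closer to the root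
  have hpen : ∀ u w, T.Adj u w → T.dist r w = T.dist r u + 1 → (p w).penultimate = u := by
    intro u w huw hd
    have hq : ((p u).concat huw).IsPath :=
      Walk.isPath_of_length_eq_dist _ (by rw [Walk.length_concat, hp, hd])
    have h := Subtype.mk.inj
      ((hT.isAcyclic.subsingleton_path r w).elim ⟨p w, hpath w⟩ ⟨_, hq⟩)
    rw [h, Walk.penultimate_concat]
  have hpar : ∀ w, T.dist r w ≠ 0 →
      T.Adj (p w).penultimate w ∧ T.dist r (p w).penultimate + 1 = T.dist r w := by
    intro w hw
    have hnil : ¬ (p w).Nil := fun h => hw (by rw [← hp w]; exact Walk.length_eq_zero_iff.2 h)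
    have hadj := Walk.adj_penultimate hnil
    have h1 : T.dist r (p w).penultimate ≤ T.dist r w - 1 := by
      have := dist_le (p w).dropLast
      rwa [Walk.length_dropLast, hp] at this
    refine ⟨hadj, ?_⟩
    rcases hT.dist_eq_dist_add_one_of_adj r hadj with h | h <;> omega
  refine ⟨fun w => (p w).penultimate, fun w => T.dist r w, ?_, fun w hw => (hpar w hw).2,
    by simp, fun w hw => ?_, fun w => ?_⟩
  · intro u w
    constructor
    · intro h
      rcases hT.dist_eq_dist_add_one_of_adj r h with hd | hd
      · exact Or.inr ⟨hd, hpen w u h.symm hd⟩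
      · exact Or.inl ⟨hd, hpen u w h hd⟩
    · rintro (⟨hd, rfl⟩ | ⟨hd, rfl⟩)
      · exact (hpar w (by omega)).1
      · exact (hpar u (by omega)).1.symm
  · exact ((hT.connected.dist_eq_zero_iff).1 hw).symm
  · obtain ⟨n, hn⟩ : ∃ n, n = T.dist r w := ⟨_, rfl⟩
    induction n generalizing w with
    | zero =>
      rw [← hn, (hT.connected.dist_eq_zero_iff).1 hn.symm]
      simp
    | succ n ih =>
      obtain ⟨h1, h2⟩ := hpar w (by omega)
      rw [hside _ _ h1, ih (p w).penultimate (by omega), ← h2, Nat.bodd_succ, Bool.xor_not]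

theorem exists_blocks {α : Type*} [Fintype α] [LinearOrder α] {K : ℕ} (hK : 0 < K)
    (hn : K ≤ Fintype.card α) :
    ∃ B : ℕ → Finset α, (∀ i j, i < j → ∀ a ∈ B i, ∀ b ∈ B j, a < b) ∧
      ∀ i < K, (Fintype.card α : ℝ) / (2 * K) ≤ #(B i) := by
  classical
  set n := Fintype.card α with hn'
  let e : Fin n ≃o α := Fintype.orderIsoFinOfCardEq α rfl
  -- the blocks consist of `m` consecutive elements each
  obtain ⟨m, hm⟩ : ∃ m, m = n / K := ⟨_, rfl⟩
  have hm0 : 0 < m := hm ▸ Nat.div_pos hn hK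
  refine ⟨fun i => univ.filter fun a => (e.symm a : ℕ) / m = i, ?_, ?_⟩
  · intro i j hij a ha b hb
    simp only [mem_filter, mem_univ, true_and] at ha hb
    by_contra! hba
    have h : (e.symm b : ℕ) ≤ e.symm a := (e.symm.le_iff_le).2 hba
    have := Nat.div_le_div_right (c := m) h
    omega
  · intro i hi
    have hKm : K * m ≤ n := hm ▸ Nat.mul_div_le n K
    have hlt : ∀ t : Fin m, i * m + t < n := fun t => by
      have : (i + 1) * m ≤ K * m := Nat.mul_le_mul_right _ hi
      have := t.2
      rw [add_mul] at *
      omega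
    have hcard : m ≤ #(univ.filter fun a => (e.symm a : ℕ) / m = i) := by
      have hinj : Function.Injective fun t : Fin m => e ⟨i * m + t, hlt t⟩ := by
        intro t t' h
        have := Fin.mk.inj (e.injective h)
        exact Fin.ext (by omega)
      calc m = #(univ.image fun t : Fin m => e ⟨i * m + t, hlt t⟩) := by
            rw [card_image_of_injective _ hinj, card_univ, Fintype.card_fin]
        _ ≤ _ := by
            refine card_le_card fun a ha => ?_
            obtain ⟨t, _, rfl⟩ := mem_image.1 ha
            simp only [mem_filter, mem_univ, true_and, OrderIso.symm_apply_apply]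
            rw [mul_comm, Nat.mul_add_div hm0, Nat.div_eq_of_lt t.2, add_zero]
    have h2 : n ≤ 2 * K * m := by
      have h3 : n < K * (m + 1) := by
        rw [hm]; exact Nat.lt_mul_div_succ n hK
      have : K ≤ K * m := Nat.le_mul_of_pos_right _ hm0
      rw [mul_add] at h3
      nlinarith
    rw [div_le_iff₀ (by positivity)]
    calc (n : ℝ) ≤ (2 * K * m : ℕ) := by exact_mod_cast h2
      _ = m * (2 * K) := by push_cast; ring
      _ ≤ _ := by gcongr

/-! ### Ordered bigraphs -/

section Ordered

variable {V₁ V₂ W₁ W₂ : Type*}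

/-- The two sides of a bigraph, as a family of sets: `B₁` on side `false` and `B₂` on side
`true`. -/
def bothSides (B₁ : Finset V₁) (B₂ : Finset V₂) (t : Bool) : Finset (V₁ ⊕ V₂) :=
  bif t then B₂.map Function.Embedding.inr else B₁.map Function.Embedding.inl

theorem bothSides_mono {B₁ C₁ : Finset V₁} {B₂ C₂ : Finset V₂} (h₁ : B₁ ⊆ C₁) (h₂ : B₂ ⊆ C₂)
    (t : Bool) : bothSides B₁ B₂ t ⊆ bothSides C₁ C₂ t := by
  cases t
  · exact map_subset_map.2 h₁
  · exact map_subset_map.2 h₂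

theorem isRight_of_adj (T : Bigraph W₁ W₂) (u w : W₁ ⊕ W₂) (h : T.graph.Adj u w) :
    w.isRight = !u.isRight := by
  rcases T.bipartite.mem_of_adj h with ⟨⟨a, rfl⟩, b, rfl⟩ | ⟨⟨a, rfl⟩, b, rfl⟩ <;> rfl

theorem card_nbr_le_degree [Fintype V₁] [Fintype V₂] (G : Bigraph V₁ V₂) (v : V₁ ⊕ V₂)
    (B : Finset (V₁ ⊕ V₂)) : #(nbr G.graph v B) ≤ G.degree v := by
  rw [Bigraph.degree, ← Set.ncard_coe_finset]
  exact Set.ncard_le_ncard (fun b hb => (mem_nbr.1 hb).2) (Set.toFinite _)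

/-- A bigraph with no large anticomplete pair is coherent. -/
theorem coherent_of_forall [Fintype V₁] [Fintype V₂] (G : Bigraph V₁ V₂) {ε c : ℝ}
    (h₁ : 1 ≤ ε * Fintype.card V₁) (h₂ : 1 ≤ ε * Fintype.card V₂)
    (hd₁ : ∀ x : V₁, (G.degree (Sum.inl x) : ℝ) ≤ ε * (Fintype.card V₂ : ℝ))
    (hd₂ : ∀ y : V₂, (G.degree (Sum.inr y) : ℝ) ≤ ε * (Fintype.card V₁ : ℝ))
    (h : ∀ (Z₁ : Finset V₁) (Z₂ : Finset V₂),
      (ε * (Fintype.card V₁ : ℝ) ≤ #Z₁ ∧ ε * (Fintype.card V₂ : ℝ) ^ (1 - c) ≤ #Z₂ ∨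
        ε * (Fintype.card V₁ : ℝ) ^ (1 - c) ≤ #Z₁ ∧ ε * (Fintype.card V₂ : ℝ) ≤ #Z₂) →
      ¬ G.Anticomplete Z₁ Z₂) :
    Coherent G.graph (bothSides univ univ) ε c := by
  have hside : ∀ t, ∀ v ∈ bothSides (univ : Finset V₁) (univ : Finset V₂) t, v.isRight = t := by
    rintro (_ | _) v hv <;> obtain ⟨x, _, rfl⟩ := mem_map.1 hv <;> rfl
  refine ⟨?_, ?_, ?_, ?_⟩
  · intro t a ha b hb hab
    have := isRight_of_adj G a b hab
    rw [hside t a ha, hside t b hb] at this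
    exact (Bool.eq_not_self t).mp this
  · rintro (_ | _)
    · simpa [bothSides] using h₁
    · simpa [bothSides] using h₂
  · rintro (_ | _) v hv <;> obtain ⟨x, _, rfl⟩ := mem_map.1 hv
    · refine le_trans (Nat.cast_le.2 (card_nbr_le_degree G _ _)) ?_
      simpa [bothSides] using hd₁ x
    · refine le_trans (Nat.cast_le.2 (card_nbr_le_degree G _ _)) ?_
      simpa [bothSides] using hd₂ x
  · rintro (_ | _) A hA B hB hAc hBc hAB <;>
      obtain ⟨A, -, rfl⟩ := subset_map_iff.1 hA <;> obtain ⟨B, -, rfl⟩ := subset_map_iff.1 hB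
    · refine h A B (Or.inl ⟨?_, ?_⟩) fun x hx y hy =>
        hAB _ (mem_map_of_mem _ hx) _ (mem_map_of_mem _ hy)
      · simpa [bothSides] using hAc
      · simpa [bothSides] using hBc
    · refine h B A (Or.inr ⟨?_, ?_⟩) fun x hx y hy hxy =>
        hAB _ (mem_map_of_mem _ hy) _ (mem_map_of_mem _ hx) hxy.symm
      · simpa [bothSides] using hBc
      · simpa [bothSides] using hAc

variable [LinearOrder V₁] [LinearOrder V₂] [LinearOrder W₁] [LinearOrder W₂]

/-- If the blocks of each side are in order, and so are the positions of the vertices of the tree,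
then a copy of the whole tree respects the orders. -/
theorem contains_of_hasCopy {G : Bigraph V₁ V₂} {T : Bigraph W₁ W₂} {root : W₁ ⊕ W₂}
    {par : W₁ ⊕ W₂ → W₁ ⊕ W₂} {lev : W₁ ⊕ W₂ → ℕ}
    (hT : IsRooted T.graph Sum.isRight root par lev) {B₁ : ℕ → Finset V₁} {B₂ : ℕ → Finset V₂}
    (hB₁ : ∀ i j, i < j → ∀ a ∈ B₁ i, ∀ b ∈ B₁ j, a < b)
    (hB₂ : ∀ i j, i < j → ∀ a ∈ B₂ i, ∀ b ∈ B₂ j, a < b) (g₁ : W₁ ↪o ℕ) (g₂ : W₂ ↪o ℕ)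
    {z : V₁ ⊕ V₂} {U : Finset (V₁ ⊕ V₂)}
    (h : HasCopy G.graph (fun t i => bothSides (B₁ i) (B₂ i) t) T.graph Sum.isRight par lev
      (Sum.elim g₁ g₂) root z U) : G.Contains T := by
  obtain ⟨f, -, -, hfB, hfA⟩ := h
  have hf₁ : ∀ w : W₁, ∃ x ∈ B₁ (g₁ w), Sum.inl x = f (Sum.inl w) := fun w =>
    mem_map.1 (hfB _ (hT.isDesc_root (Sum.inl w)))
  have hf₂ : ∀ w : W₂, ∃ x ∈ B₂ (g₂ w), Sum.inr x = f (Sum.inr w) := fun w =>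
    mem_map.1 (hfB _ (hT.isDesc_root (Sum.inr w)))
  choose f₁ hf₁B hf₁ using hf₁
  choose f₂ hf₂B hf₂ using hf₂
  have hm₁ : StrictMono f₁ := fun w w' hw =>
    hB₁ _ _ ((g₁.lt_iff_lt).2 hw) _ (hf₁B w) _ (hf₁B w')
  have hm₂ : StrictMono f₂ := fun w w' hw =>
    hB₂ _ _ ((g₂.lt_iff_lt).2 hw) _ (hf₂B w) _ (hf₂B w')
  refine ⟨OrderEmbedding.ofStrictMono f₁ hm₁, OrderEmbedding.ofStrictMono f₂ hm₂, fun u w => ?_⟩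
  have hf : ∀ w, Sum.map f₁ f₂ w = f w := by
    rintro (w | w)
    · exact hf₁ w
    · exact hf₂ w
  rw [OrderEmbedding.coe_ofStrictMono, OrderEmbedding.coe_ofStrictMono, hf, hf]
  exact hfA u w (hT.isDesc_root u) (hT.isDesc_root w)

theorem exists_orderEmbedding_mem {W : Type*} [Fintype W] [LinearOrder W] {P : Finset ℕ}
    (hP : Fintype.card W ≤ #P) : ∃ g : W ↪o ℕ, ∀ w, g w ∈ P :=
  ⟨(Fintype.orderIsoFinOfCardEq W rfl).symm.toOrderEmbedding.trans (P.orderEmbOfCardLe hP),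
    fun _ => P.orderEmbOfCardLe_mem hP _⟩

/-- Coherent ordered bigraphs contain all ordered trees. -/
theorem exists_contains_of_coherent [Fintype W₁] [Fintype W₂] {T : Bigraph W₁ W₂}
    (hT : T.graph.IsTree) {c : ℝ} (hc : 0 < c) :
    ∃ ε : ℝ, 0 < ε ∧ ∀ {V₁ V₂ : Type*} [Fintype V₁] [Fintype V₂] [LinearOrder V₁] [LinearOrder V₂]
      (G : Bigraph V₁ V₂), Coherent G.graph (bothSides univ univ) ε c → G.Contains T := by
  obtain ⟨root⟩ := hT.connected.nonempty
  obtain ⟨par, lev, hR⟩ := exists_isRooted hT (isRight_of_adj T) root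
  obtain ⟨h, hh⟩ : ∃ h, ∀ w, lev w < h :=
    ⟨univ.sup lev + 1, fun w => Nat.lt_succ_of_le (le_sup (f := lev) (mem_univ w))⟩
  have hW : 0 < Fintype.card W₁ + Fintype.card W₂ := by
    rw [← Fintype.card_sum]
    exact Fintype.card_pos_iff.2 ⟨root⟩
  -- at level `0`, the positions of each side suffice for all vertices of the tree
  obtain ⟨K, κ, ε, hK, hκ, hε, H⟩ := exists_hasLevel hR hc h hh h 0 root.isRight (zero_add h)
    (fun v => by rw [hR.side_eq v]; simp) _ _ hW hW Unit
  refine ⟨min ε (1 / K), lt_min hε (by positivity), ?_⟩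
  intro V₁ V₂ _ _ _ _ G hG
  have hcard : ∀ t, K ≤ #(bothSides (univ : Finset V₁) (univ : Finset V₂) t) := by
    intro t
    have := (hG.mono (min_le_right _ _)).large t
    rw [one_div_mul_eq_div, le_div_iff₀ (by positivity), one_mul] at this
    exact_mod_cast this
  obtain ⟨B₁, hB₁, hB₁c⟩ := exists_blocks (α := V₁) hK (by simpa [bothSides] using hcard false)
  obtain ⟨B₂, hB₂, hB₂c⟩ := exists_blocks (α := V₂) hK (by simpa [bothSides] using hcard true)
  obtain ⟨P, hP, hP', L, Z, U, -, -, -, hZ, -, -, -, hcopy⟩ :=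
    H G.graph _ (fun t i => bothSides (B₁ i) (B₂ i) t) (hG.mono (min_le_left _ _))
      (fun t i => bothSides_mono (subset_univ _) (subset_univ _) t) (by
        rintro (_ | _) i hi
        · simpa [bothSides] using hB₁c i hi
        · simpa [bothSides] using hB₂c i hi)
  have hPc : ∀ t, #(P t) = Fintype.card W₁ + Fintype.card W₂ := by
    intro t
    rcases Bool.eq_or_eq_not t root.isRight with h | h <;> rw [h]
    · exact hP
    · exact hP'
  obtain ⟨g₁, hg₁⟩ := exists_orderEmbedding_mem (W := W₁) (P := P false) (by rw [hPc]; omega)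
  obtain ⟨g₂, hg₂⟩ := exists_orderEmbedding_mem (W := W₂) (P := P true) (by rw [hPc]; omega)
  have hφ : IsPlacement Sum.isRight P (Sum.elim g₁ g₂) := by
    refine ⟨?_, ?_⟩
    · rintro (w | w)
      · exact hg₁ w
      · exact hg₂ w
    · rintro (w | w) (w' | w') hs hw
      · exact congrArg _ (g₁.injective hw)
      · cases hs
      · cases hs
      · exact congrArg _ (g₂.injective hw)
  obtain ⟨z, hz⟩ : (Z (Sum.elim g₁ g₂ root) ()).Nonempty := by
    rw [← card_pos]
    have h1 := hZ _ (hφ.1 root) ()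
    have h2 : (0 : ℝ) < #(bothSides (univ : Finset V₁) (univ : Finset V₂) root.isRight) := by
      exact_mod_cast hK.trans_le (hcard _)
    have h3 : (0 : ℝ) < #(Z (Sum.elim g₁ g₂ root) ()) := lt_of_lt_of_le (by positivity) h1
    exact_mod_cast h3
  exact contains_of_hasCopy hR hB₁ hB₂ g₁ g₂
    (hcopy _ (hφ.1 root) () z hz root hR.lev_root _ hφ rfl)

end Ordered

theorem anticomplete_univ {V₁ V₂ : Type*} [Fintype V₁] [Fintype V₂] {G : Bigraph V₁ V₂}
    (h : (∀ x : V₁, G.degree (Sum.inl x) = 0) ∨ ∀ y : V₂, G.degree (Sum.inr y) = 0) :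
    G.Anticomplete univ univ := by
  have hdeg : ∀ v w, G.graph.Adj v w → G.degree v ≠ 0 := fun v w hvw h0 => by
    rw [Bigraph.degree, Set.ncard_eq_zero (Set.toFinite _)] at h0
    exact (Set.ext_iff.1 h0 w).1 hvw
  intro x _ y _ hxy
  rcases h with h | h
  · exact hdeg _ _ hxy (h x)
  · exact hdeg _ _ hxy.symm (h y)

theorem mul_rpow_le_card {n : ℕ} (hn : 0 < n) {ε c : ℝ} (hε1 : ε ≤ 1) (hc : 0 < c) :
    ε * (n : ℝ) ^ (1 - c) ≤ n := by
  have h1 : (1 : ℝ) ≤ n := by exact_mod_cast hn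
  have h2 : (n : ℝ) ^ (1 - c) ≤ n := by
    calc (n : ℝ) ^ (1 - c) ≤ (n : ℝ) ^ (1 : ℝ) :=
          Real.rpow_le_rpow_of_exponent_le h1 (by linarith)
      _ = n := Real.rpow_one _
  calc ε * (n : ℝ) ^ (1 - c) ≤ 1 * n := by gcongr
    _ = n := one_mul _

end BigraphTree

open BigraphTree in
theorem mainTheorem2
    (W₁ : Type u₁) (W₂ : Type u₂) [Fintype W₁] [Fintype W₂] [LinearOrder W₁] [LinearOrder W₂]
    (T : Bigraph W₁ W₂) (hT : T.graph.IsTree) (c : ℝ) (hc : 0 < c) :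
    ∃ ε : ℝ, 0 < ε ∧
      ∀ (V₁ : Type v₁) (V₂ : Type v₂) [Fintype V₁] [Fintype V₂] [LinearOrder V₁] [LinearOrder V₂]
        (G : Bigraph V₁ V₂),
        Nonempty (V₁ ⊕ V₂) →
        ¬ G.Contains T →
        (∀ x : V₁, (G.degree (Sum.inl x) : ℝ) < ε * (Fintype.card V₂ : ℝ)) →
        (∀ y : V₂, (G.degree (Sum.inr y) : ℝ) < ε * (Fintype.card V₁ : ℝ)) →
        ∃ (Z₁ : Finset V₁) (Z₂ : Finset V₂), G.Anticomplete Z₁ Z₂ ∧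
          ((ε * (Fintype.card V₁ : ℝ) ≤ (Z₁.card : ℝ) ∧
              ε * (Fintype.card V₂ : ℝ) ^ (1 - c) ≤ (Z₂.card : ℝ)) ∨
            (ε * (Fintype.card V₁ : ℝ) ^ (1 - c) ≤ (Z₁.card : ℝ) ∧
              ε * (Fintype.card V₂ : ℝ) ≤ (Z₂.card : ℝ))) := by
  obtain ⟨ε₀, hε₀, H⟩ := exists_contains_of_coherent.{u₁, u₂, v₁, v₂} hT hc
  obtain ⟨ε, hε, hε0, hε1⟩ : ∃ ε : ℝ, 0 < ε ∧ ε ≤ ε₀ ∧ ε ≤ 1 :=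
    ⟨min ε₀ 1, lt_min hε₀ one_pos, min_le_left _ _, min_le_right _ _⟩
  refine ⟨ε, hε, ?_⟩
  intro V₁ V₂ _ _ _ _ G hV hGT hd₁ hd₂
  -- a vertex of one side has a degree bound that is positive only if the other side is nonempty
  have hpos : 0 < Fintype.card V₁ ∧ 0 < Fintype.card V₂ := by
    have h₁ : 0 < Fintype.card V₁ → 0 < Fintype.card V₂ := fun h => by
      obtain ⟨x⟩ := Fintype.card_pos_iff.1 h
      have := pos_of_mul_pos_right ((Nat.cast_nonneg _).trans_lt (hd₁ x)) hε.le
      exact_mod_cast this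
    have h₂ : 0 < Fintype.card V₂ → 0 < Fintype.card V₁ := fun h => by
      obtain ⟨y⟩ := Fintype.card_pos_iff.1 h
      have := pos_of_mul_pos_right ((Nat.cast_nonneg _).trans_lt (hd₂ y)) hε.le
      exact_mod_cast this
    obtain ⟨x | y⟩ := hV
    · have h := Fintype.card_pos_iff.2 ⟨x⟩
      exact ⟨h, h₁ h⟩
    · have h := Fintype.card_pos_iff.2 ⟨y⟩
      exact ⟨h₂ h, h⟩
  by_cases hsmall : 1 ≤ ε * Fintype.card V₁ ∧ 1 ≤ ε * Fintype.card V₂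
  · by_contra hcon
    push Not at hcon
    refine hGT (H G (Coherent.mono (coherent_of_forall G hsmall.1 hsmall.2 (fun x => (hd₁ x).le)
      (fun y => (hd₂ y).le) fun Z₁ Z₂ hZ hanti => ?_) hε0))
    rcases hZ with ⟨h1, h2⟩ | ⟨h1, h2⟩
    · exact absurd h2 (not_le.2 ((hcon Z₁ Z₂ hanti).1 h1))
    · exact absurd h2 (not_le.2 ((hcon Z₁ Z₂ hanti).2 h1))
  -- a degree bound is less than one, so there are no edges
  · have hzero : ∀ {d : ℕ} {x : ℝ}, (d : ℝ) < x → ¬ 1 ≤ x → d = 0 := fun {d x} h1 h2 => by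
      have : (d : ℝ) < 1 := h1.trans (not_le.1 h2)
      exact Nat.lt_one_iff.1 (by exact_mod_cast this)
    refine ⟨Finset.univ, Finset.univ, anticomplete_univ ?_, Or.inl ⟨?_, ?_⟩⟩
    · rcases not_and_or.1 hsmall with h | h
      · exact Or.inr fun y => hzero (hd₂ y) h
      · exact Or.inl fun x => hzero (hd₁ x) h
    · rw [Finset.card_univ]
      exact mul_le_of_le_one_left (Nat.cast_nonneg _) hε1
    · rw [Finset.card_univ]
      exact mul_rpow_le_card hpos.2 hε1 hc
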